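/- For a positive integer $n$ let $T_n=\mathbb R^2/(\sqrt n\,\mathbb Z)^2$ be the torus of side $\sqrt n$ with the metric $d_T$ inherited from the Euclidean metric. For $r>0$, let $\mathcal T(n,r)$ be the random geometric graph on $n$ vertices whose positions are independent and uniformly distributed on $[0,\sqrt n]^2$ (regarded as points of $T_n$), two distinct vertices being adjacent when the distance $d_T$ between their positions is at most $r$. Let $\mathcal F=\mathcal F(n,r)$ be the family of axis-parallel squares of side length $10^5r$ with left-bottom vertices at the points $(10^4ri,10^4rj)$, where $i,j\ge 0$ are integers with $10^4ri<\sqrt n$ and $10^4rj<\sqrt n$; the squares are regarded as subsets of $T_n$ (they wrap around). For $S\in\mathcal F$, the internal square $I(S)$ is the axis-parallel square of side length $10^5r-2r$ with the same centre as $S$. For a set $W$ of vertices of a graph $G$, the $W$-signature of a vertex $v$ is the vector $(d_G(s,v))_{s\in W}$ of graph distances (with value $\infty$ if there is no path). Let $r=r(n)$ satisfy $70\sqrt{\log n}\le r<\sqrt n/4$ for all sufficiently large $n$, let $G\in\mathcal T(n,r)$, and let $$ w=w(n)=\begin{cases}10^{15}\,r^{4/3} & \text{if } r\ge \log^{3/2}n,\\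 3\cdot10^{16}\log^2 n & \text{if } 100\log n\le r<\log^{3/2}n,\\ 2\cdot 10^{10}\,r^2 & \text{otherwise.}\end{cases} $$ Then, with probability tending to $1$ as $n\to\infty$, the following holds: for every square $S\in\mathcal F$ there is a set $W=W(S)$ of at most $w$ vertices of $G$ lying in $S$ such that the vertices of $G$ lying in $I(S)$ have pairwise distinct $W$-signatures. -/

import Mathlib

open Filter MeasureTheory
open scoped Topology

noncomputable section

namespace LocalizationRGG

/-- The flat torus `ℝ² / (Lℤ)²` with the metric inherited from the Euclidean metric: the
`ℓ²`-product of two circles of length `L`. -/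
abbrev Torus (L : ℝ) : Type := WithLp 2 (AddCircle L × AddCircle L)

/-- The quotient map from the plane to the torus. -/
def toTorus (L : ℝ) (p : ℝ × ℝ) : Torus L :=
  WithLp.toLp 2 ((p.1 : AddCircle L), (p.2 : AddCircle L))

/-- The torus distance between (the classes of) two points of the plane. -/
def torusDist (L : ℝ) (p q : ℝ × ℝ) : ℝ := dist (toTorus L p) (toTorus L q)

/-- The uniform probability distribution on the square `[0, √n]²`. -/
def uniformSquare (n : ℕ) : Measure (ℝ × ℝ) :=
  ProbabilityTheory.cond volume (Set.Icc 0 (√(n : ℝ)) ×ˢ Set.Icc 0 (√(n : ℝ)))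

/-- The joint law of `n` independent uniform points of `[0, √n]²`. -/
def pointsLaw (n : ℕ) : Measure (Fin n → ℝ × ℝ) := Measure.pi fun _ => uniformSquare n

/-- The geometric graph on the torus of side `√n` with vertex positions `x` and threshold
distance `r`. For `x` of law `pointsLaw n` this is the random geometric graph on the torus. -/
def torusGraph {n : ℕ} (r : ℝ) (x : Fin n → ℝ × ℝ) : SimpleGraph (Fin n) where
  Adj i j := i ≠ j ∧ torusDist (√(n : ℝ)) (x i) (x j) ≤ r
  symm := ⟨fun i j h => ⟨h.1.symm, by
    have h2 := h.2
    unfold torusDist at h2 ⊢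
    rwa [dist_comm]⟩⟩
  loopless := ⟨fun _ h => h.1 rfl⟩

/-- The `W`-signature of a vertex `v`: the vector of graph distances from the elements of `W`
to `v` (equal to `⊤` between different components). -/
def signature {V : Type*} (G : SimpleGraph V) (W : Finset V) (v : V) : W → ℕ∞ :=
  fun s => G.edist (s : V) v

/-- Sensors on `W` distinguish the vertices in `A`: no two of them share a `W`-signature. -/
def Distinguishes {V : Type*} (G : SimpleGraph V) (W : Finset V) (A : Set V) : Prop :=
  Set.InjOn (signature G W) A

/-- An axis-parallel square, given by its left-bottom vertex and its side length. -/
structure Square where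
  corner : ℝ × ℝ
  side : ℝ

/-- The points of the plane that belong to the (closed) square. -/
def Square.points (S : Square) : Set (ℝ × ℝ) :=
  Set.Icc S.corner.1 (S.corner.1 + S.side) ×ˢ Set.Icc S.corner.2 (S.corner.2 + S.side)

/-- The internal square `I(S)`: same centre, parallel sides, side length smaller by `2 * r`. -/
def Square.internal (r : ℝ) (S : Square) : Square where
  corner := (S.corner.1 + r, S.corner.2 + r)
  side := S.side - 2 * r

/-- The vertices whose positions on the torus of side `√n` lie in (the image of) the square. -/
def verticesIn {n : ℕ} (x : Fin n → ℝ × ℝ) (S : Square) : Set (Fin n) :=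
  {i | toTorus (√(n : ℝ)) (x i) ∈ toTorus (√(n : ℝ)) '' S.points}

/-- The family `𝓕` of squares of side length `10⁵ r` with left-bottom vertices at the points
`(10⁴ r i, 10⁴ r j)`, `i, j ≥ 0`, both coordinates being smaller than `√n`. -/
def squareFamily (n : ℕ) (r : ℝ) : Set Square :=
  {S | ∃ i j : ℕ, 10 ^ 4 * r * i < √(n : ℝ) ∧ 10 ^ 4 * r * j < √(n : ℝ) ∧
    S = ⟨(10 ^ 4 * r * i, 10 ^ 4 * r * j), 10 ^ 5 * r⟩}

open Classical in
/-- The bound `w` on the number of sensors. -/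
def sensorBound (n : ℕ) (r : ℝ) : ℝ :=
  if Real.log n ^ (3 / 2 : ℝ) ≤ r then 10 ^ 15 * r ^ (4 / 3 : ℝ)
  else if 100 * Real.log n ≤ r then 3 * 10 ^ 16 * Real.log n ^ 2
  else 2 * 10 ^ 10 * r ^ 2

end LocalizationRGG

end

/-!
Two vertices of a square `S` are distinguished as soon as some sensor is adjacent to exactly one of
them, so it suffices that `W` meets the set `Δ u v` of points of the configuration in the symmetric
difference of the discs of radius `r` around `u` and `v`. That symmetric difference has area of
order `r * min (dist u v) r`, so for `log n ≤ l` all pairs at distance at least a multiple of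
`l / r` simultaneously have about as many separating points as expected, and a random subset of `S`
of density `p` of order `l² / r²`, hence of size of order `l²`, meets all but a bounded number of
their sets `Δ u v`. The closer pairs are rare: a first moment bound for packings of disjoint copies
of a pattern shows that, outside `O(l²)` exceptional points which are made sensors, no two points
lie within distance of order `l / r`, no point has two others within distance of order `K l / r`,
and the number of pairs within distance of order `k l / r` is at most of order `4ᵏ l²`. This
works for `r² ≤ l³`, and the two main regimes are `l = r ^ (2 / 3)` and `l = log n`; in the
remaining one all vertices of `S` are sensors.
-/

namespace LocalizationRGG

open ProbabilityTheory

section ProductMeasure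

theorem measureReal_prod_le_mul {α β : Type*} [MeasurableSpace α] [MeasurableSpace β]
    {μ : Measure α} [IsFiniteMeasure μ] {ν : Measure β} [IsFiniteMeasure ν] {E : Set (α × β)}
    (hE : MeasurableSet E) {B : Set α} (hB : MeasurableSet B) (hEB : E ⊆ Prod.fst ⁻¹' B)
    {ε : ℝ} (hε : 0 ≤ ε) (hsection : ∀ x ∈ B, ν.real (Prod.mk x ⁻¹' E) ≤ ε) :
    (μ.prod ν).real E ≤ μ.real B * ε := by
  have hle (x : α) : ν (Prod.mk x ⁻¹' E) ≤ B.indicator (fun _ => ENNReal.ofReal ε) x := by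
    by_cases hx : x ∈ B
    · rw [Set.indicator_of_mem hx, ← ofReal_measureReal]
      exact ENNReal.ofReal_le_ofReal (hsection x hx)
    · have hempty : Prod.mk x ⁻¹' E = ∅ :=
        Set.eq_empty_of_forall_notMem fun z hz => hx (hEB hz)
      simp [hempty]
  refine ENNReal.toReal_le_of_le_ofReal (by positivity) ?_
  calc (μ.prod ν) E = ∫⁻ x, ν (Prod.mk x ⁻¹' E) ∂μ := Measure.prod_apply hE
    _ ≤ ∫⁻ x, B.indicator (fun _ => ENNReal.ofReal ε) x ∂μ := lintegral_mono hle
    _ = ENNReal.ofReal ε * μ B := lintegral_indicator_const hB _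
    _ = ENNReal.ofReal (μ.real B * ε) := by
      rw [mul_comm (μ.real B), ENNReal.ofReal_mul hε, ofReal_measureReal]

variable {T ι κ : Type*} [MeasurableSpace T] [Fintype ι] [Fintype κ] (ν : Measure T)
  [IsProbabilityMeasure ν]

theorem measurePreserving_comp_injective {φ : κ → ι} (hφ : Function.Injective φ) :
    MeasurePreserving (fun y : ι → T => y ∘ φ) (Measure.pi fun _ => ν)
      (Measure.pi fun _ => ν) := by
  refine ⟨by fun_prop, ?_⟩
  have hindep : iIndepFun (fun (i : ι) (y : ι → T) => y i) (Measure.pi fun _ : ι => ν) :=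
    iIndepFun_pi (X := fun _ => id) fun _ => aemeasurable_id
  refine ((hindep.precomp hφ).map_fun_eq_pi_map fun k =>
    (measurable_pi_apply (φ k)).aemeasurable).trans ?_
  congr 1 with k : 1
  exact (measurePreserving_eval (fun _ : ι => ν) (φ k)).map_eq

theorem measurePreserving_comp_sum {κ' : Type*} [Fintype κ'] {φ : κ → ι} {ψ : κ' → ι}
    (hφψ : Function.Injective (Sum.elim φ ψ)) :
    MeasurePreserving (fun y : ι → T => (y ∘ φ, y ∘ ψ)) (Measure.pi fun _ => ν)
      ((Measure.pi fun _ : κ => ν).prod (Measure.pi fun _ : κ' => ν)) :=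
  (measurePreserving_sumPiEquivProdPi fun _ : κ ⊕ κ' => ν).comp
    (measurePreserving_comp_injective ν hφψ)

theorem measurePreserving_curry :
    MeasurePreserving (Function.curry : (κ × ι → T) → κ → ι → T) (Measure.pi fun _ => ν)
      (Measure.pi fun _ => Measure.pi fun _ => ν) := by
  refine ⟨(MeasurableEquiv.curry κ ι T).measurable, ?_⟩
  simpa only [Measure.infinitePi_eq_pi, MeasurableEquiv.coe_curry] using
    Measure.infinitePi_map_curry fun (_ : κ) (_ : ι) => ν

theorem measureReal_forall_comp_mem {F : Finset (κ → ι)}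
    (hinj : ∀ v ∈ F, Function.Injective v)
    (hdisj : (F : Set (κ → ι)).PairwiseDisjoint Set.range) {E : Set (κ → T)}
    (hE : MeasurableSet E) :
    (Measure.pi fun _ : ι => ν).real {y | ∀ v ∈ F, y ∘ v ∈ E} =
      (Measure.pi fun _ : κ => ν).real E ^ F.card := by
  have hφ : Function.Injective fun p : F × κ => p.1.1 p.2 := by
    rintro ⟨⟨v, hv⟩, k⟩ ⟨⟨w, hw⟩, l⟩ (h : v k = w l)
    obtain rfl : v = w := hdisj.elim_set hv hw (v k) ⟨k, rfl⟩ ⟨l, h.symm⟩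
    rw [hinj v hv h]
  have hpre : {y : ι → T | ∀ v ∈ F, y ∘ v ∈ E} =
      (Function.curry ∘ fun y => y ∘ fun p : F × κ => p.1.1 p.2) ⁻¹'
        Set.univ.pi fun _ => E := by
    ext y
    simp only [Set.mem_preimage, Set.mem_univ_pi, Subtype.forall]
    rfl
  have hpres := (measurePreserving_curry ν).comp (measurePreserving_comp_injective ν hφ)
  rw [hpre, hpres.measureReal_preimage
    (MeasurableSet.univ_pi fun _ => hE).nullMeasurableSet, measureReal_def, Measure.pi_pi]
  simp [measureReal_def]

end ProductMeasure

section Packing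

variable {T ι κ : Type*}

/-- The placements `v ∈ F` form a packing of copies of the pattern `E` in the point configuration
`y`: each of them maps `κ` injectively onto indices of points that realize the pattern, and no
index is used twice. -/
structure IsPacking (E : Set (κ → T)) (y : ι → T) (F : Finset (κ → ι)) : Prop where
  injective : ∀ v ∈ F, Function.Injective v
  comp_mem : ∀ v ∈ F, y ∘ v ∈ E
  pairwiseDisjoint : (F : Set (κ → ι)).PairwiseDisjoint Set.range

/-- The point configuration `y` contains `m` disjoint copies of the pattern `E`. -/
def HasPacking (E : Set (κ → T)) (y : ι → T) (m : ℕ) : Prop :=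
  ∃ F : Finset (κ → ι), IsPacking E y F ∧ F.card = m

theorem IsPacking.mono {E : Set (κ → T)} {y : ι → T} {F F' : Finset (κ → ι)}
    (h : IsPacking E y F) (hF' : F' ⊆ F) : IsPacking E y F' where
  injective v hv := h.injective v (hF' hv)
  comp_mem v hv := h.comp_mem v (hF' hv)
  pairwiseDisjoint := h.pairwiseDisjoint.subset (by exact_mod_cast hF')

theorem IsPacking.card_lt {E : Set (κ → T)} {y : ι → T} {F : Finset (κ → ι)} {m : ℕ}
    (h : IsPacking E y F) (hm : ¬ HasPacking E y m) : F.card < m := by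
  by_contra! hle
  obtain ⟨F', hF', hcard⟩ := Finset.exists_subset_card_eq hle
  exact hm ⟨F', h.mono hF', hcard⟩

theorem IsPacking.insert [DecidableEq (κ → ι)] {E : Set (κ → T)} {y : ι → T}
    {F : Finset (κ → ι)} {v : κ → ι} (h : IsPacking E y F) (hinj : Function.Injective v)
    (hmem : y ∘ v ∈ E) (hdisj : ∀ w ∈ F, Disjoint (Set.range v) (Set.range w)) :
    IsPacking E y (insert v F) where
  injective := Finset.forall_mem_insert _ _ _ |>.2 ⟨hinj, h.injective⟩
  comp_mem := Finset.forall_mem_insert _ _ _ |>.2 ⟨hmem, h.comp_mem⟩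
  pairwiseDisjoint := by
    rw [Finset.coe_insert]
    exact h.pairwiseDisjoint.insert fun w hw _ => hdisj w hw

variable [Fintype κ]

-- The images of a maximal packing meet every copy of the pattern.
theorem exists_cover_of_not_hasPacking [Finite ι] [Nonempty κ] {E : Set (κ → T)} {y : ι → T} {m : ℕ}
    (h : ¬ HasPacking E y m) :
    ∃ U : Finset ι, U.card ≤ m * Fintype.card κ ∧
      ∀ v : κ → ι, Function.Injective v → y ∘ v ∈ E → ∃ k, v k ∈ U := by
  classical
  have hempty : IsPacking E y (∅ : Finset (κ → ι)) := ⟨by simp, by simp, by simp⟩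
  obtain ⟨F, -, hF⟩ := Set.Finite.exists_le_maximal
    (Set.toFinite {F : Finset (κ → ι) | IsPacking E y F}) hempty
  refine ⟨F.biUnion fun v => Finset.univ.image v, ?_, fun v hinj hmem => ?_⟩
  · calc _ ≤ F.card * Fintype.card κ := Finset.card_biUnion_le_card_mul _ _ _ fun _ _ =>
          Finset.card_image_le
      _ ≤ m * Fintype.card κ := by gcongr; exact (hF.prop.card_lt h).le
  · by_contra! hv
    have hdisj : ∀ w ∈ F, Disjoint (Set.range v) (Set.range w) := by
      rintro w hw
      rw [Set.disjoint_left]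
      rintro - ⟨k, rfl⟩ ⟨l, hl⟩
      exact hv k (Finset.mem_biUnion.2 ⟨w, hw, Finset.mem_image.2 ⟨l, Finset.mem_univ l, hl⟩⟩)
    have hvF : v ∈ F := hF.le_of_ge (hF.prop.insert hinj hmem hdisj) (Finset.subset_insert v F)
      (Finset.mem_insert_self v F)
    exact Set.not_disjoint_iff_nonempty_inter.2
      (by rw [Set.inter_self]; exact Set.range_nonempty v) (hdisj v hvF)

theorem choose_mul_pow_le_half_pow {N m : ℕ} {e : ℝ} (he : 0 ≤ e) (hm : 6 * (N * e) ≤ m) :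
    N.choose m * e ^ m ≤ (1 / 2) ^ m := by
  calc N.choose m * e ^ m ≤ (N : ℝ) ^ m / m.factorial * e ^ m := by
        gcongr
        exact Nat.choose_le_pow_div m N
    _ = (N * e) ^ m / m.factorial := by ring
    _ ≤ (m / 6) ^ m / m.factorial := by
        gcongr
        linarith
    _ = (1 / 6) ^ m * ((m : ℝ) ^ m / m.factorial) := by ring
    _ ≤ (1 / 6) ^ m * Real.exp m := by
        gcongr
        exact Real.pow_div_factorial_le_exp _ m.cast_nonneg m
    _ = (1 / 6 * Real.exp 1) ^ m := by rw [mul_pow, ← Real.exp_nat_mul, mul_one]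
    _ ≤ (1 / 2) ^ m := by
        gcongr
        linarith [Real.exp_one_lt_d9]

theorem measureReal_hasPacking_le [Fintype ι] [MeasurableSpace T] (ν : Measure T)
    [IsProbabilityMeasure ν] {E : Set (κ → T)} (hE : MeasurableSet E) {m : ℕ}
    (hm : 6 * ((Fintype.card ι : ℝ) ^ Fintype.card κ * (Measure.pi fun _ : κ => ν).real E) ≤ m) :
    (Measure.pi fun _ : ι => ν).real {y | HasPacking E y m} ≤ (1 / 2) ^ m := by
  classical
  set μ := Measure.pi fun _ : ι => ν
  set e := (Measure.pi fun _ : κ => ν).real E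
  let 𝓕 := (Finset.univ : Finset (κ → ι)).powersetCard m
  have hone : ∀ F ∈ 𝓕, μ.real {y | IsPacking E y F} ≤ e ^ m := by
    intro F hF
    by_cases h : (∀ v ∈ F, Function.Injective v) ∧
        (F : Set (κ → ι)).PairwiseDisjoint Set.range
    · rw [← (Finset.mem_powersetCard.1 hF).2, ← measureReal_forall_comp_mem ν h.1 h.2 hE]
      exact measureReal_mono fun y hy => hy.comp_mem
    · have hempty : {y : ι → T | IsPacking E y F} = ∅ :=
        Set.eq_empty_of_forall_notMem fun y hy => h ⟨hy.injective, hy.pairwiseDisjoint⟩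
      rw [hempty, measureReal_empty]
      positivity
  calc μ.real {y | HasPacking E y m} ≤ μ.real (⋃ F ∈ 𝓕, {y | IsPacking E y F}) := by
        refine measureReal_mono (fun y ⟨F, hF, hcard⟩ => ?_) (measure_ne_top _ _)
        exact Set.mem_biUnion
          (Finset.mem_coe.2 (Finset.mem_powersetCard.2 ⟨F.subset_univ, hcard⟩)) hF
    _ ≤ ∑ F ∈ 𝓕, μ.real {y | IsPacking E y F} := measureReal_biUnion_finset_le _ _
    _ ≤ 𝓕.card * e ^ m := by
        simpa [nsmul_eq_mul] using Finset.sum_le_card_nsmul _ _ _ hone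
    _ = (Fintype.card ι ^ Fintype.card κ).choose m * e ^ m := by
        rw [Finset.card_powersetCard, Finset.card_univ, Fintype.card_fun]
    _ ≤ (1 / 2) ^ m := choose_mul_pow_le_half_pow measureReal_nonneg (by exact_mod_cast hm)

end Packing

section StarPattern

variable {T : Type*} [PseudoMetricSpace T]

/-- The configurations of `s + 1` points whose first point lies in `B` and has all the others
within distance `d`. -/
def starPattern (B : Set T) (d : ℝ) (s : ℕ) : Set (Fin (s + 1) → T) :=
  {z | z 0 ∈ B ∧ ∀ b : Fin s, dist (z b.succ) (z 0) ≤ d}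

variable [MeasurableSpace T] [OpensMeasurableSpace T] [SecondCountableTopology T]

theorem measurableSet_starPattern {B : Set T} (hB : MeasurableSet B) (d : ℝ) (s : ℕ) :
    MeasurableSet (starPattern B d s) := by
  have hleaf (b : Fin s) :
      MeasurableSet {z : Fin (s + 1) → T | dist (z b.succ) (z 0) ≤ d} :=
    measurableSet_le (by fun_prop) measurable_const
  simp only [starPattern, Set.ofPred_and, Set.ofPred_forall]
  exact (hB.preimage (measurable_pi_apply 0)).inter (MeasurableSet.iInter hleaf)

variable (ν : Measure T) [IsProbabilityMeasure ν]

theorem measureReal_starPattern_le {B : Set T} (hB : MeasurableSet B) {d : ℝ} (s : ℕ) {γ : ℝ}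
    (hγ0 : 0 ≤ γ) (hγ : ∀ u, ν.real (Metric.closedBall u d) ≤ γ) :
    (Measure.pi fun _ : Fin (s + 1) => ν).real (starPattern B d s) ≤ ν.real B * γ ^ s := by
  let E : Set (T × (Fin s → T)) := {q | q.1 ∈ B ∧ ∀ b, dist (q.2 b) q.1 ≤ d}
  have hpres := measurePreserving_piFinSuccAbove (fun _ : Fin (s + 1) => ν) 0
  have hpre : starPattern B d s = MeasurableEquiv.piFinSuccAbove (fun _ => T) 0 ⁻¹' E := rfl
  have hE : MeasurableSet E := by
    rw [← (MeasurableEquiv.piFinSuccAbove (fun _ => T) 0).measurableSet_preimage, ← hpre]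
    exact measurableSet_starPattern hB d s
  rw [hpre, hpres.measureReal_preimage hE.nullMeasurableSet]
  refine measureReal_prod_le_mul hE hB (fun q hq => hq.1) (by positivity) fun u hu => ?_
  have hsection : Prod.mk u ⁻¹' E = Set.univ.pi fun _ => Metric.closedBall u d := by
    ext z
    simp [E, hu]
  rw [hsection, measureReal_def, Measure.pi_pi, Finset.prod_const, ENNReal.toReal_pow,
    Finset.card_univ, Fintype.card_fin]
  exact pow_le_pow_left₀ measureReal_nonneg (hγ u) s

theorem measureReal_hasPacking_starPattern_le {ι : Type*} [Fintype ι] {B : Set T}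
    (hB : MeasurableSet B) {d : ℝ} {s m : ℕ} {β γ : ℝ} (hβ : Fintype.card ι * ν.real B ≤ β)
    (hγ : ∀ u, Fintype.card ι * ν.real (Metric.closedBall u d) ≤ γ) (hm : 6 * (β * γ ^ s) ≤ m) :
    (Measure.pi fun _ : ι => ν).real {y | HasPacking (starPattern B d s) y m} ≤
      (1 / 2) ^ m := by
  refine measureReal_hasPacking_le ν (measurableSet_starPattern hB d s) (le_trans ?_ hm)
  have hβ0 : 0 ≤ β := le_trans (by positivity) hβ
  obtain ⟨u⟩ := ν.nonempty_of_neZero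
  have hγ0 : 0 ≤ γ := le_trans (by positivity) (hγ u)
  rw [Fintype.card_fin]
  refine mul_le_mul_of_nonneg_left ?_ (by norm_num)
  rcases (Fintype.card ι).eq_zero_or_pos with h0 | hpos
  · rw [h0, Nat.cast_zero, zero_pow s.succ_ne_zero, zero_mul]
    positivity
  have hpos' : (0 : ℝ) < Fintype.card ι := by exact_mod_cast hpos
  have hstar := measureReal_starPattern_le ν hB s (γ := γ / Fintype.card ι) (by positivity)
    fun u => by rw [le_div_iff₀' hpos']; exact hγ u
  calc (Fintype.card ι : ℝ) ^ (s + 1) * (Measure.pi fun _ => ν).real (starPattern B d s)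
      ≤ Fintype.card ι ^ (s + 1) * (ν.real B * (γ / Fintype.card ι) ^ s) := by gcongr
    _ = Fintype.card ι * ν.real B * γ ^ s := by
        rw [pow_succ, div_pow]
        field_simp
    _ ≤ β * γ ^ s := by gcongr

end StarPattern

section HitCount

variable {T ι : Type*} [Fintype ι]

open Classical in
/-- The indices of the points of the configuration `y` that lie in `A`. -/
noncomputable def hits (A : Set T) (y : ι → T) : Finset ι := Finset.univ.filter fun i => y i ∈ A

@[simp]
theorem mem_hits {A : Set T} {y : ι → T} {i : ι} : i ∈ hits A y ↔ y i ∈ A := by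
  simp [hits]

/-- The number of points of the configuration `y` that lie in `A`. -/
noncomputable def hitCount (A : Set T) (y : ι → T) : ℕ := (hits A y).card

theorem hitCount_eq_sum (A : Set T) (y : ι → T) :
    (hitCount A y : ℝ) = ∑ i, A.indicator (fun _ => (1 : ℝ)) (y i) := by
  classical
  simp [hitCount, hits, Set.indicator_apply]

theorem hitCount_le_card (A : Set T) (y : ι → T) : hitCount A y ≤ Fintype.card ι :=
  Finset.card_le_univ _

variable [MeasurableSpace T]

theorem measurable_hitCount_section {α : Type*} [MeasurableSpace α] {R : Set (α × T)}
    (hR : MeasurableSet R) :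
    Measurable fun q : α × (ι → T) => (hitCount (Prod.mk q.1 ⁻¹' R) q.2 : ℝ) := by
  simp_rw [hitCount_eq_sum]
  refine Finset.measurable_sum _ fun i _ => ?_
  have hpair : Measurable fun q : α × (ι → T) => (q.1, q.2 i) := by fun_prop
  exact (measurable_const.indicator hR).comp hpair

theorem measurable_hitCount {A : Set T} (hA : MeasurableSet A) :
    Measurable fun y : ι → T => (hitCount A y : ℝ) := by
  simp_rw [hitCount_eq_sum]
  exact Finset.measurable_sum _ fun i _ =>
    (measurable_const.indicator hA).comp (measurable_pi_apply i)

variable (ν : Measure T) [IsProbabilityMeasure ν]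

theorem integrable_exp_hitCount {A : Set T} (hA : MeasurableSet A) (t : ℝ) :
    Integrable (fun y : ι → T => Real.exp (t * hitCount A y)) (Measure.pi fun _ => ν) := by
  refine Integrable.of_bound (C := Real.exp (|t| * Fintype.card ι))
    ((measurable_hitCount hA).const_mul t).exp.aestronglyMeasurable (ae_of_all _ fun y => ?_)
  rw [Real.norm_eq_abs, Real.abs_exp, Real.exp_le_exp]
  calc t * hitCount A y ≤ |t| * hitCount A y := by gcongr; exact le_abs_self t
    _ ≤ |t| * Fintype.card ι := by gcongr; exact hitCount_le_card A y

theorem integral_exp_mul_indicator {A : Set T} (hA : MeasurableSet A) (t : ℝ) :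
    ∫ u, Real.exp (t * A.indicator (fun _ => (1 : ℝ)) u) ∂ν =
      1 + ν.real A * (Real.exp t - 1) := by
  have hexp (u : T) : Real.exp (t * A.indicator (fun _ => (1 : ℝ)) u) =
      1 + A.indicator (fun _ => Real.exp t - 1) u := by
    by_cases hu : u ∈ A <;> simp [hu]
  simp_rw [hexp]
  rw [integral_add (integrable_const _) ((integrable_const _).indicator hA),
    integral_indicator_const _ hA]
  simp

theorem mgf_hitCount_le {A : Set T} (hA : MeasurableSet A) (t : ℝ) :
    mgf (fun y : ι → T => (hitCount A y : ℝ)) (Measure.pi fun _ => ν) t ≤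
      Real.exp (Fintype.card ι * ν.real A * (Real.exp t - 1)) := by
  have hpos : 0 ≤ 1 + ν.real A * (Real.exp t - 1) := by
    rw [← integral_exp_mul_indicator ν hA]
    exact integral_nonneg fun u => (Real.exp_pos _).le
  calc mgf (fun y : ι → T => (hitCount A y : ℝ)) (Measure.pi fun _ => ν) t
      = ∏ _i : ι, ∫ u, Real.exp (t * A.indicator (fun _ => (1 : ℝ)) u) ∂ν := by
        rw [← integral_fintype_prod_eq_prod]
        simp only [mgf, hitCount_eq_sum, Finset.mul_sum, Real.exp_sum]
    _ = (1 + ν.real A * (Real.exp t - 1)) ^ Fintype.card ι := by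
        rw [integral_exp_mul_indicator ν hA, Finset.prod_const, Finset.card_univ]
    _ ≤ Real.exp (ν.real A * (Real.exp t - 1)) ^ Fintype.card ι := by
        gcongr
        linarith [Real.add_one_le_exp (ν.real A * (Real.exp t - 1))]
    _ = Real.exp (Fintype.card ι * ν.real A * (Real.exp t - 1)) := by
        rw [mul_assoc, Real.exp_nat_mul]

theorem measureReal_two_mul_le_hitCount_le {A : Set T} (hA : MeasurableSet A) {a : ℝ}
    (ha : Fintype.card ι * ν.real A ≤ a) :
    (Measure.pi fun _ : ι => ν).real {y | 2 * a ≤ hitCount A y} ≤ Real.exp (-(a / 4)) := by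
  have ha0 : 0 ≤ a := le_trans (by positivity) ha
  have hlog : (0.69 : ℝ) < Real.log 2 := by linarith [Real.log_two_gt_d9]
  refine (measure_ge_le_exp_mul_mgf (2 * a) (t := Real.log 2) (by linarith)
    (integrable_exp_hitCount ν hA _)).trans ?_
  refine (mul_le_mul_of_nonneg_left (mgf_hitCount_le ν hA _) (Real.exp_nonneg _)).trans ?_
  rw [← Real.exp_add, Real.exp_le_exp, Real.exp_log two_pos]
  nlinarith

theorem measureReal_hitCount_le_le {A : Set T} (hA : MeasurableSet A) {a : ℝ}
    (ha : a ≤ Fintype.card ι * ν.real A) (b : ℝ) :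
    (Measure.pi fun _ : ι => ν).real {y | (hitCount A y : ℝ) ≤ b} ≤
      Real.exp (b - 3 / 5 * a) := by
  refine (measure_le_le_exp_mul_mgf b (t := -1) (by norm_num)
    (integrable_exp_hitCount ν hA _)).trans ?_
  refine (mul_le_mul_of_nonneg_left (mgf_hitCount_le ν hA _) (Real.exp_nonneg _)).trans ?_
  rw [← Real.exp_add, Real.exp_le_exp]
  have hexp : Real.exp (-1) ≤ 2 / 5 := by linarith [Real.exp_neg_one_lt_d9]
  have hmean : 0 ≤ Fintype.card ι * ν.real A := by positivity
  nlinarith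

theorem measurableSet_hitCount_section_le {α : Type*} [MeasurableSpace α] {R : Set (α × T)}
    (hR : MeasurableSet R) {g : α → ℝ} (hg : Measurable g) {s : ℝ} :
    MeasurableSet {q : α × (ι → T) |
      s ≤ g q.1 ∧ (hitCount (Prod.mk q.1 ⁻¹' R) q.2 : ℝ) ≤ g q.1 / 20} :=
  (measurableSet_le measurable_const (hg.comp measurable_fst)).inter <|
    measurableSet_le (measurable_hitCount_section hR) ((hg.comp measurable_fst).div_const _)

theorem measureReal_prod_hitCount_section_le {α : Type*} [MeasurableSpace α] {μ : Measure α}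
    [IsProbabilityMeasure μ] {R : Set (α × T)} (hR : MeasurableSet R) {g : α → ℝ}
    (hg : Measurable g) (hgR : ∀ a, g a ≤ Fintype.card ι * ν.real (Prod.mk a ⁻¹' R)) {s : ℝ}
    (hs : 0 ≤ s) :
    (μ.prod (Measure.pi fun _ : ι => ν)).real
      {q | s ≤ g q.1 ∧ (hitCount (Prod.mk q.1 ⁻¹' R) q.2 : ℝ) ≤ g q.1 / 20} ≤
      Real.exp (-(s / 2)) := by
  have hsection : ∀ a ∈ {a | s ≤ g a}, (Measure.pi fun _ : ι => ν).real (Prod.mk a ⁻¹'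
      {q : α × (ι → T) | s ≤ g q.1 ∧ (hitCount (Prod.mk q.1 ⁻¹' R) q.2 : ℝ) ≤ g q.1 / 20}) ≤
        Real.exp (-(s / 2)) := fun a ha => by
    have hsg : s ≤ g a := ha
    calc _ ≤ (Measure.pi fun _ : ι => ν).real
          {y | (hitCount (Prod.mk a ⁻¹' R) y : ℝ) ≤ g a / 20} := measureReal_mono fun y hy => hy.2
      _ ≤ Real.exp (g a / 20 - 3 / 5 * g a) :=
          measureReal_hitCount_le_le ν (hR.preimage measurable_prodMk_left) (hgR a) _
      _ ≤ Real.exp (-(s / 2)) := by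
          gcongr
          linarith
  exact (measureReal_prod_le_mul (measurableSet_hitCount_section_le hR hg)
    (measurableSet_le measurable_const hg) (fun q hq => hq.1) (Real.exp_nonneg _) hsection).trans
    (mul_le_of_le_one_left (Real.exp_nonneg _) measureReal_le_one)

end HitCount

section Separators

variable {T ι : Type*} [Fintype ι]

open Classical in
/-- The indices `k` that tell `i` and `j` apart: `i` and `j` themselves, and the indices of the
points `u` of the configuration `y` for which the relation `R` holds between `(y i, y j)` and
`u`. -/
noncomputable def separators (R : Set ((T × T) × T)) (y : ι → T) (i j : ι) : Finset ι :=
  Finset.univ.filter fun k => k = i ∨ k = j ∨ ((y i, y j), y k) ∈ R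

theorem mem_separators {R : Set ((T × T) × T)} {y : ι → T} {i j k : ι} :
    k ∈ separators R y i j ↔ k = i ∨ k = j ∨ ((y i, y j), y k) ∈ R := by
  simp [separators]

theorem hitCount_comp_le_card_separators {κ : Type*} [Fintype κ] {φ : κ → ι}
    (hφ : Function.Injective φ) (R : Set ((T × T) × T)) (y : ι → T) (i j : ι) :
    hitCount (Prod.mk (y i, y j) ⁻¹' R) (y ∘ φ) ≤ (separators R y i j).card := by
  refine Finset.card_le_card_of_injOn φ (fun k hk => ?_) hφ.injOn
  rw [Finset.mem_coe, mem_hits] at hk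
  exact mem_separators.2 (.inr (.inr hk))

variable [MeasurableSpace T] (ν : Measure T) [IsProbabilityMeasure ν] {R : Set ((T × T) × T)}
  {f : T × T → ℝ} {s : ℝ}

theorem measureReal_card_separators_le (hR : MeasurableSet R) (hf : Measurable f)
    (hfR : ∀ q, f q ≤ (Fintype.card ι - 2) * ν.real (Prod.mk q ⁻¹' R)) (hs : 0 ≤ s) {i j : ι}
    (hij : i ≠ j) :
    (Measure.pi fun _ : ι => ν).real
      {y | s ≤ f (y i, y j) ∧ ((separators R y i j).card : ℝ) ≤ f (y i, y j) / 20} ≤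
      Real.exp (-(s / 2)) := by
  classical
  let J := {k : ι // k ∉ ({i, j} : Finset ι)}
  have hcard : (Fintype.card J : ℝ) = Fintype.card ι - 2 := by
    rw [Fintype.card_subtype_compl, Fintype.card_coe, Finset.card_pair hij, Nat.cast_sub]
    · norm_num
    · exact (Finset.card_pair hij).symm.trans_le (Finset.card_le_univ _)
  have hinj : Function.Injective (Sum.elim ![i, j] (Subtype.val : J → ι)) := by
    refine Function.Injective.sumElim ?_ Subtype.val_injective ?_
    · simpa [Function.Injective, Fin.forall_fin_two, eq_comm] using hij
    · rintro a ⟨k, hk⟩ rfl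
      fin_cases a <;> simp at hk
  let R' : Set ((Fin 2 → T) × T) := (fun p => ((p.1 0, p.1 1), p.2)) ⁻¹' R
  have hR' : MeasurableSet R' := hR.preimage (by fun_prop)
  let g : (Fin 2 → T) → ℝ := fun u => f (u 0, u 1)
  have hg : Measurable g := hf.comp (by fun_prop)
  calc _ ≤ (Measure.pi fun _ : ι => ν).real
          ((fun y => (y ∘ ![i, j], y ∘ (Subtype.val : J → ι))) ⁻¹'
            {q | s ≤ g q.1 ∧ (hitCount (Prod.mk q.1 ⁻¹' R') q.2 : ℝ) ≤ g q.1 / 20}) :=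
        measureReal_mono fun y hy => ⟨hy.1, le_trans
          (by exact_mod_cast hitCount_comp_le_card_separators Subtype.val_injective R y i j) hy.2⟩
    _ = _ := (measurePreserving_comp_sum ν hinj).measureReal_preimage
          (measurableSet_hitCount_section_le hR' hg).nullMeasurableSet
    _ ≤ Real.exp (-(s / 2)) := measureReal_prod_hitCount_section_le ν hR' hg
        (fun u => by rw [hcard]; exact hfR (u 0, u 1)) hs

theorem measureReal_exists_card_separators_le (hR : MeasurableSet R) (hf : Measurable f)
    (hfR : ∀ q, f q ≤ (Fintype.card ι - 2) * ν.real (Prod.mk q ⁻¹' R)) (hs : 0 ≤ s) :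
    (Measure.pi fun _ : ι => ν).real {y | ∃ i j, i ≠ j ∧ s ≤ f (y i, y j) ∧
      ((separators R y i j).card : ℝ) ≤ f (y i, y j) / 20} ≤
      Fintype.card ι ^ 2 * Real.exp (-(s / 2)) := by
  classical
  let D : Finset (ι × ι) := Finset.univ.filter fun e => e.1 ≠ e.2
  calc _ ≤ (Measure.pi fun _ : ι => ν).real (⋃ e ∈ D, {y | s ≤ f (y e.1, y e.2) ∧
          ((separators R y e.1 e.2).card : ℝ) ≤ f (y e.1, y e.2) / 20}) := by
        refine measureReal_mono (fun y ⟨i, j, hij, h⟩ => ?_) (measure_ne_top _ _)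
        exact Set.mem_biUnion (x := (i, j)) (by simpa [D] using hij) h
    _ ≤ D.card • Real.exp (-(s / 2)) :=
        (measureReal_biUnion_finset_le _ _).trans <| Finset.sum_le_card_nsmul _ _ _ fun e he =>
          measureReal_card_separators_le ν hR hf hfR hs (Finset.mem_filter.1 he).2
    _ ≤ (Fintype.card ι : ℝ) ^ 2 * Real.exp (-(s / 2)) := by
        rw [nsmul_eq_mul]
        gcongr
        exact_mod_cast (Finset.card_le_univ D).trans_eq (by rw [Fintype.card_prod, sq])

end Separators

section Circle

theorem exists_coe_eq_abs_eq_norm {L : ℝ} (u : AddCircle L) :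
    ∃ x : ℝ, (x : AddCircle L) = u ∧ |x| = ‖u‖ := by
  obtain ⟨x, rfl⟩ := QuotientAddGroup.mk_surjective u
  have hperiod : ((round (L⁻¹ * x) * L : ℝ) : AddCircle L) = 0 :=
    (AddCircle.coe_eq_zero_iff L).2 ⟨round (L⁻¹ * x), by simp⟩
  exact ⟨x - round (L⁻¹ * x) * L, by rw [AddCircle.coe_sub, hperiod, sub_zero],
    (AddCircle.norm_eq L).symm⟩

theorem image_coe_Icc_eq_closedBall (L c ρ : ℝ) :
    ((↑) : ℝ → AddCircle L) '' Set.Icc (c - ρ) (c + ρ) = Metric.closedBall (c : AddCircle L) ρ := by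
  ext u
  rw [Metric.mem_closedBall, dist_eq_norm]
  constructor
  · rintro ⟨t, ht, rfl⟩
    rw [← AddCircle.coe_sub]
    exact QuotientAddGroup.norm_mk_le_norm.trans
      (abs_le.2 ⟨by linarith [ht.1], by linarith [ht.2]⟩)
  · intro hu
    obtain ⟨x, hx, habs⟩ := exists_coe_eq_abs_eq_norm (u - (c : AddCircle L))
    rw [← habs, abs_le] at hu
    exact ⟨c + x, ⟨by linarith, by linarith⟩, by rw [AddCircle.coe_add, hx, add_sub_cancel]⟩

variable {L : ℝ} [hL : Fact (0 < L)]

theorem lt_norm_coe {p x : ℝ} (hpx : p < x) (hxp : x < L - p) : p < ‖(x : AddCircle L)‖ := by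
  have hL0 := hL.out
  rw [AddCircle.norm_eq]
  rcases le_or_gt (round (L⁻¹ * x)) 0 with hk | hk
  · have hk' : (round (L⁻¹ * x) : ℝ) ≤ 0 := by exact_mod_cast hk
    exact lt_of_lt_of_le (by nlinarith) (le_abs_self _)
  · have hk' : (1 : ℝ) ≤ round (L⁻¹ * x) := by exact_mod_cast hk
    exact lt_of_lt_of_le (by nlinarith) (neg_le_abs _)

theorem sub_le_volumeReal_of_Ioo {A : Set (AddCircle L)} (hA : MeasurableSet A) {x y : ℝ}
    (hyx : y ≤ x + L) (h : ∀ t ∈ Set.Ioo x y, (t : AddCircle L) ∈ A) :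
    y - x ≤ volume.real A := by
  rw [measureReal_def, ← ENNReal.ofReal_le_iff_le_toReal (measure_ne_top _ _),
    ← (AddCircle.measurePreserving_mk L x).measure_preimage hA.nullMeasurableSet,
    ← Real.volume_Ioo, Measure.restrict_apply' measurableSet_Ioc]
  exact measure_mono fun t ht => ⟨h t ht, ht.1, ht.2.le.trans hyx⟩

theorem min_le_volumeReal_arc_diff_coe (a : ℝ) {h p : ℝ} (hh : h ≤ L / 2) (hp : p ≤ L / 4) :
    min h (2 * p) ≤ volume.real (Metric.closedBall (a : AddCircle L) p \
      Metric.closedBall ((a + h : ℝ) : AddCircle L) p) := by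
  have hmin : min h (2 * p) ≤ h := min_le_left _ _
  have hmin' : min h (2 * p) ≤ 2 * p := min_le_right _ _
  have hL0 := hL.out
  rw [← add_sub_cancel_left (a - p) (min h (2 * p))]
  refine sub_le_volumeReal_of_Ioo (Metric.isClosed_closedBall.measurableSet.diff
    Metric.isClosed_closedBall.measurableSet) (by linarith) fun t ht => ⟨?_, ?_⟩
  · rw [← image_coe_Icc_eq_closedBall]
    exact ⟨t, ⟨by linarith [ht.1], by linarith [ht.2]⟩, rfl⟩
  · rw [Metric.mem_closedBall', not_le, dist_eq_norm, ← AddCircle.coe_sub]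
    exact lt_norm_coe (by linarith [ht.2]) (by linarith [ht.1])

theorem min_dist_le_volumeReal_arc_diff (u v : AddCircle L) {p : ℝ} (hp : p ≤ L / 4) :
    min (dist u v) (2 * p) ≤ volume.real (Metric.closedBall u p \ Metric.closedBall v p) := by
  have hhalf (u : AddCircle L) : ‖u‖ ≤ L / 2 := by
    simpa [abs_of_pos hL.out] using AddCircle.norm_le_half_period L hL.out.ne' (x := u)
  obtain ⟨a, rfl⟩ := QuotientAddGroup.mk_surjective u
  obtain ⟨h, hh, habs⟩ := exists_coe_eq_abs_eq_norm (v - (a : AddCircle L))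
  obtain rfl : v = ((a + h : ℝ) : AddCircle L) := by rw [AddCircle.coe_add, hh, add_sub_cancel]
  rw [dist_comm, dist_eq_norm]
  change min ‖((a + h : ℝ) : AddCircle L) - (a : AddCircle L)‖ (2 * p) ≤ _
  rw [← habs]
  have hle : |h| ≤ L / 2 := habs ▸ hhalf _
  rcases le_total 0 h with h0 | h0
  · rw [abs_of_nonneg h0] at hle ⊢
    exact min_le_volumeReal_arc_diff_coe a hle hp
  · rw [abs_of_nonpos h0] at hle ⊢
    refine (min_le_volumeReal_arc_diff_coe (-a) hle hp).trans_eq ?_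
    rw [← neg_add, AddCircle.coe_neg, AddCircle.coe_neg, measureReal_def, measureReal_def,
      ← Measure.measure_preimage_neg (volume : Measure (AddCircle L))]
    congr 2
    ext t
    simp

end Circle

section TorusGeometry

/-- The torus of side `L` with the metric inherited from the sup metric of the plane, whose balls
are the axis-parallel squares. -/
abbrev SupTorus (L : ℝ) : Type := AddCircle L × AddCircle L

/-- The Euclidean distance on the torus. -/
noncomputable def euclDist {L : ℝ} (u v : SupTorus L) : ℝ :=
  dist (WithLp.toLp 2 u : Torus L) (WithLp.toLp 2 v)

/-- The triples `((u, v), w)` for which `w` lies in exactly one of the discs of radius `r` around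
`u` and `v`. -/
def discSymmDiff (L r : ℝ) : Set ((SupTorus L × SupTorus L) × SupTorus L) :=
  {q | ¬ (euclDist q.1.1 q.2 ≤ r ↔ euclDist q.1.2 q.2 ≤ r)}

theorem euclDist_comm {L : ℝ} (u v : SupTorus L) : euclDist u v = euclDist v u := dist_comm _ _

theorem dist_le_euclDist {L : ℝ} (u v : SupTorus L) : dist u v ≤ euclDist u v := by
  have h := (WithLp.prod_lipschitzWith_ofLp 2 (AddCircle L) (AddCircle L)).dist_le_mul
    (WithLp.toLp 2 u) (WithLp.toLp 2 v)
  rwa [NNReal.coe_one, one_mul] at h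

theorem euclDist_le_iff {L : ℝ} (u v : SupTorus L) {r : ℝ} (hr : 0 ≤ r) :
    euclDist u v ≤ r ↔ dist u.1 v.1 ^ 2 + dist u.2 v.2 ^ 2 ≤ r ^ 2 := by
  rw [euclDist, WithLp.prod_dist_eq_of_L2, Real.sqrt_le_left hr, WithLp.toLp_fst, WithLp.toLp_fst,
    WithLp.toLp_snd, WithLp.toLp_snd]

theorem euclDist_swap {L : ℝ} (u v : SupTorus L) : euclDist u.swap v.swap = euclDist u v := by
  simp only [euclDist, WithLp.prod_dist_eq_of_L2, WithLp.toLp_fst, WithLp.toLp_snd, Prod.fst_swap,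
    Prod.snd_swap, add_comm]

theorem continuous_euclDist {L : ℝ} :
    Continuous fun q : SupTorus L × SupTorus L => euclDist q.1 q.2 :=
  ((WithLp.prod_continuous_toLp 2 _ _).comp continuous_fst).dist
    ((WithLp.prod_continuous_toLp 2 _ _).comp continuous_snd)

theorem measurableSet_discSymmDiff (L r : ℝ) : MeasurableSet (discSymmDiff L r) := by
  have : OpensMeasurableSpace (SupTorus L × SupTorus L) := inferInstance
  have : OpensMeasurableSpace ((SupTorus L × SupTorus L) × SupTorus L) :=
    Prod.opensMeasurableSpace
  have hdisc {f g : (SupTorus L × SupTorus L) × SupTorus L → SupTorus L} (hf : Continuous f)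
      (hg : Continuous g) : MeasurableSet {q | euclDist (f q) (g q) ≤ r} :=
    (isClosed_le (continuous_euclDist.comp (hf.prodMk hg)) continuous_const).measurableSet
  exact ((hdisc (by fun_prop) continuous_snd).iff (hdisc (by fun_prop) continuous_snd)).compl

variable {L : ℝ} [hL : Fact (0 < L)]

theorem volumeReal_closedBall_le (c : SupTorus L) {ρ : ℝ} (hρ : 0 ≤ ρ) :
    volume.real (Metric.closedBall c ρ) ≤ 4 * ρ ^ 2 := by
  have hmin : 0 ≤ min L (2 * ρ) := le_min hL.out.le (by positivity)
  rw [← closedBall_prod_same, Measure.volume_eq_prod, measureReal_prod_prod, measureReal_def,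
    measureReal_def, AddCircle.volume_closedBall, AddCircle.volume_closedBall,
    ENNReal.toReal_ofReal hmin]
  calc min L (2 * ρ) * min L (2 * ρ) ≤ 2 * ρ * (2 * ρ) := by
        gcongr <;> exact min_le_right _ _
    _ = 4 * ρ ^ 2 := by ring

-- At height `z` the disc around `u` cuts out an arc of half-length at least `4r/5`.
theorem min_dist_fst_le_volumeReal_disc_diff {u v : SupTorus L} {r : ℝ} (hr : 0 ≤ r)
    (hrL : r ≤ L / 4) {z : AddCircle L} (hz : dist u.2 z ≤ 3 * r / 5)
    (huv : dist u.2 z ≤ dist v.2 z) :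
    min (dist u.1 v.1) r ≤
      volume.real {x | euclDist u (x, z) ≤ r ∧ ¬ euclDist v (x, z) ≤ r} := by
  have hz0 : 0 ≤ dist u.2 z := dist_nonneg
  set p := √(r ^ 2 - dist u.2 z ^ 2)
  have hp2 : p ^ 2 = r ^ 2 - dist u.2 z ^ 2 := Real.sq_sqrt (by nlinarith)
  have hp : 4 * r / 5 ≤ p := Real.le_sqrt_of_sq_le (by nlinarith)
  have hpr : p ≤ r := Real.sqrt_le_iff.2 ⟨hr, by nlinarith⟩
  calc min (dist u.1 v.1) r ≤ min (dist u.1 v.1) (2 * p) := min_le_min_left _ (by linarith)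
    _ ≤ volume.real (Metric.closedBall u.1 p \ Metric.closedBall v.1 p) :=
        min_dist_le_volumeReal_arc_diff u.1 v.1 (by linarith)
    _ ≤ _ := by
      refine measureReal_mono fun x ⟨hxu, hxv⟩ => ?_
      rw [Metric.mem_closedBall'] at hxu hxv
      rw [Set.mem_ofPred_eq, euclDist_le_iff _ _ hr, euclDist_le_iff _ _ hr]
      constructor
      · nlinarith [dist_nonneg (x := u.1) (y := x)]
      · nlinarith [dist_nonneg (x := v.1) (y := x)]

theorem min_dist_fst_le_volumeReal_discSymmDiff_slice (u v : SupTorus L) {r : ℝ} (hr : 0 ≤ r)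
    (hrL : r ≤ L / 4) {z : AddCircle L} (hz : dist u.2 z ≤ 3 * r / 5) :
    min (dist u.1 v.1) r ≤ volume.real {x | ((u, v), (x, z)) ∈ discSymmDiff L r} := by
  rcases le_total (dist u.2 z) (dist v.2 z) with huv | hvu
  · refine (min_dist_fst_le_volumeReal_disc_diff hr hrL hz huv).trans (measureReal_mono ?_)
    exact fun x hx hiff => hx.2 (hiff.1 hx.1)
  · rw [dist_comm u.1]
    refine (min_dist_fst_le_volumeReal_disc_diff hr hrL (hvu.trans hz) hvu).trans
      (measureReal_mono ?_)
    exact fun x hx hiff => hx.2 (hiff.2 hx.1)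

theorem mul_le_measureReal_prod {α β : Type*} [MeasurableSpace α] [MeasurableSpace β]
    {μ : Measure α} [IsFiniteMeasure μ] {ν : Measure β} [IsFiniteMeasure ν] {E : Set (α × β)}
    (hE : MeasurableSet E) {B : Set β} (hB : MeasurableSet B) {ε : ℝ} (hε : 0 ≤ ε)
    (hslice : ∀ z ∈ B, ε ≤ μ.real {x | (x, z) ∈ E}) :
    ε * ν.real B ≤ (μ.prod ν).real E := by
  have hle (z : β) : B.indicator (fun _ => ENNReal.ofReal ε) z ≤ μ {x | (x, z) ∈ E} :=
    Set.indicator_apply_le' (fun hz => ENNReal.ofReal_le_of_le_toReal (hslice z hz))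
      fun _ => zero_le
  rw [measureReal_def, measureReal_def, ← ENNReal.toReal_ofReal hε, ← ENNReal.toReal_mul,
    ← lintegral_indicator_const hB, Measure.prod_apply_symm hE]
  refine ENNReal.toReal_mono ?_ (lintegral_mono hle)
  rw [← Measure.prod_apply_symm hE]
  exact measure_ne_top _ _

theorem mul_min_dist_fst_le_volumeReal_discSymmDiff (u v : SupTorus L) {r : ℝ} (hr : 0 ≤ r)
    (hrL : r ≤ L / 4) :
    6 / 5 * (r * min (dist u.1 v.1) r) ≤
      volume.real (Prod.mk (u, v) ⁻¹' discSymmDiff L r) := by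
  have hball : volume.real (Metric.closedBall u.2 (3 * r / 5)) = 6 / 5 * r := by
    rw [measureReal_def, AddCircle.volume_closedBall, min_eq_right (by linarith [hL.out]),
      ENNReal.toReal_ofReal (by positivity)]
    ring
  calc 6 / 5 * (r * min (dist u.1 v.1) r)
      = min (dist u.1 v.1) r * volume.real (Metric.closedBall u.2 (3 * r / 5)) := by
        rw [hball]
        ring
    _ ≤ _ := mul_le_measureReal_prod
        ((measurableSet_discSymmDiff L r).preimage measurable_prodMk_left)
        Metric.isClosed_closedBall.measurableSet (le_min dist_nonneg hr) fun z hz =>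
          min_dist_fst_le_volumeReal_discSymmDiff_slice u v hr hrL (Metric.mem_closedBall'.1 hz)

theorem volumeReal_discSymmDiff_swap (u v : SupTorus L) (r : ℝ) :
    volume.real (Prod.mk (u.swap, v.swap) ⁻¹' discSymmDiff L r) =
      volume.real (Prod.mk (u, v) ⁻¹' discSymmDiff L r) := by
  have hswap : MeasurePreserving (Prod.swap : SupTorus L → SupTorus L) volume volume :=
    Measure.measurePreserving_swap
  rw [← hswap.measureReal_preimage
    ((measurableSet_discSymmDiff L r).preimage measurable_prodMk_left).nullMeasurableSet]
  congr 1
  ext w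
  simp only [discSymmDiff, Set.mem_preimage, Set.mem_ofPred_eq, euclDist_swap]

theorem mul_min_dist_le_volumeReal_discSymmDiff (u v : SupTorus L) {r : ℝ} (hr : 0 ≤ r)
    (hrL : r ≤ L / 4) :
    6 / 5 * (r * min (dist u v) r) ≤ volume.real (Prod.mk (u, v) ⁻¹' discSymmDiff L r) := by
  rw [Prod.dist_eq]
  rcases max_choice (dist u.1 v.1) (dist u.2 v.2) with h | h
  · rw [h]
    exact mul_min_dist_fst_le_volumeReal_discSymmDiff u v hr hrL
  · rw [h, ← volumeReal_discSymmDiff_swap]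
    exact mul_min_dist_fst_le_volumeReal_discSymmDiff u.swap v.swap hr hrL

end TorusGeometry

section UniformTorus

variable {n : ℕ}

/-- The quotient map from the plane to the torus of side `√n`. -/
noncomputable def toSupTorus (n : ℕ) (p : ℝ × ℝ) : SupTorus √(n : ℝ) := (p.1, p.2)

theorem torusDist_eq_euclDist (p q : ℝ × ℝ) :
    torusDist √(n : ℝ) p q = euclDist (toSupTorus n p) (toSupTorus n q) := rfl

theorem mem_verticesIn_iff {x : Fin n → ℝ × ℝ} {S : Square} {i : Fin n} :
    i ∈ verticesIn x S ↔ toSupTorus n (x i) ∈ Metric.closedBall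
      (toSupTorus n (S.corner.1 + S.side / 2, S.corner.2 + S.side / 2)) (S.side / 2) := by
  have hcoord (a b : ℝ) : Metric.closedBall ((a + b / 2 : ℝ) : AddCircle √(n : ℝ)) (b / 2) =
      ((↑) : ℝ → AddCircle √(n : ℝ)) '' Set.Icc a (a + b) := by
    rw [← image_coe_Icc_eq_closedBall]
    ring_nf
  have hball : Metric.closedBall
      (toSupTorus n (S.corner.1 + S.side / 2, S.corner.2 + S.side / 2)) (S.side / 2) =
        toSupTorus n '' S.points := by
    rw [toSupTorus, ← closedBall_prod_same, hcoord, hcoord, Set.prod_image_image_eq]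
    rfl
  have htorus : toTorus √(n : ℝ) = WithLp.toLp 2 ∘ toSupTorus n := rfl
  rw [hball, verticesIn, Set.mem_ofPred_eq, htorus, Set.image_comp]
  exact (WithLp.toLp_injective 2).mem_set_image

/-- The uniform probability distribution on the torus of side `√n`. -/
noncomputable def torusLaw (n : ℕ) [Fact (0 < √(n : ℝ))] : Measure (SupTorus √(n : ℝ)) :=
  (n : ENNReal)⁻¹ • volume

variable [hL : Fact (0 < √(n : ℝ))]

theorem measurePreserving_toSupTorus :
    MeasurePreserving (toSupTorus n) (uniformSquare n) (torusLaw n) := by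
  have hcircle := AddCircle.measurePreserving_mk √(n : ℝ) 0
  rw [zero_add, Measure.restrict_congr_set Ioc_ae_eq_Icc] at hcircle
  have hsquare : uniformSquare n = (n : ENNReal)⁻¹ •
      ((volume.restrict (Set.Icc 0 √(n : ℝ))).prod (volume.restrict (Set.Icc 0 √(n : ℝ)))) := by
    rw [uniformSquare, ProbabilityTheory.cond, Measure.prod_restrict, ← Measure.volume_eq_prod]
    congr 2
    rw [Measure.volume_eq_prod, Measure.prod_prod, Real.volume_Icc, sub_zero,
      ← ENNReal.ofReal_mul (Real.sqrt_nonneg _), Real.mul_self_sqrt n.cast_nonneg,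
      ENNReal.ofReal_natCast]
  rw [hsquare]
  exact (hcircle.prod hcircle).smul_measure ((n : ENNReal)⁻¹)

instance : IsProbabilityMeasure (torusLaw n) := by
  refine ⟨?_⟩
  have hn : (n : ENNReal) ≠ 0 := by exact_mod_cast (Real.sqrt_pos.1 hL.out).ne'
  rw [torusLaw, Measure.smul_apply, Measure.volume_eq_prod, ← Set.univ_prod_univ,
    Measure.prod_prod, AddCircle.measure_univ, ← ENNReal.ofReal_mul (Real.sqrt_nonneg _),
    Real.mul_self_sqrt n.cast_nonneg, ENNReal.ofReal_natCast, smul_eq_mul]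
  exact ENNReal.inv_mul_cancel hn (ENNReal.natCast_ne_top n)

instance : IsProbabilityMeasure (uniformSquare n) :=
  ⟨by
    have h := (measurePreserving_toSupTorus (n := n)).measure_preimage nullMeasurableSet_univ
    rwa [Set.preimage_univ, measure_univ (μ := torusLaw n)] at h⟩

instance : IsProbabilityMeasure (pointsLaw n) := by
  unfold pointsLaw
  infer_instance

theorem measurePreserving_toSupTorus_comp :
    MeasurePreserving (fun x : Fin n → ℝ × ℝ => toSupTorus n ∘ x) (pointsLaw n)
      (Measure.pi fun _ => torusLaw n) :=
  measurePreserving_pi _ _ fun _ => measurePreserving_toSupTorus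

theorem mul_torusLawReal (A : Set (SupTorus √(n : ℝ))) :
    n * (torusLaw n).real A = volume.real A := by
  have hn : (n : ℝ) ≠ 0 := (Real.sqrt_pos.1 hL.out).ne'
  rw [torusLaw, measureReal_ennreal_smul_apply, ENNReal.toReal_inv, ENNReal.toReal_natCast,
    mul_inv_cancel_left₀ hn]

theorem mul_min_dist_le_torusLawReal_discSymmDiff (hn : 12 ≤ n) {r : ℝ} (hr : 0 ≤ r)
    (hrn : r ≤ √(n : ℝ) / 4) (q : SupTorus √(n : ℝ) × SupTorus √(n : ℝ)) :
    r * min (dist q.1 q.2) r ≤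
      (n - 2) * (torusLaw n).real (Prod.mk q ⁻¹' discSymmDiff √(n : ℝ) r) := by
  have hn' : (12 : ℝ) ≤ n := by exact_mod_cast hn
  have harea := mul_min_dist_le_volumeReal_discSymmDiff q.1 q.2 hr hrn
  rw [← mul_torusLawReal] at harea
  nlinarith [measureReal_nonneg (μ := torusLaw n) (s := Prod.mk q ⁻¹' discSymmDiff √(n : ℝ) r)]

end UniformTorus

section HittingSet

variable {ι E : Type*} {V : Finset ι} {p : ℝ}

/-- The probability that a random subset of `V`, containing each element independently with
probability `p`, is equal to `W`. -/
def binomialWeight (V : Finset ι) (p : ℝ) (W : Finset ι) : ℝ :=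
  p ^ W.card * (1 - p) ^ (V.card - W.card)

theorem sum_binomialWeight (V : Finset ι) (p : ℝ) :
    ∑ W ∈ V.powerset, binomialWeight V p W = 1 := by
  simp only [binomialWeight, Finset.sum_pow_mul_eq_add_pow, add_sub_cancel, one_pow]

theorem sum_binomialWeight_disjoint [DecidableEq ι] {A : Finset ι} (hA : A ⊆ V) :
    ∑ W ∈ V.powerset with Disjoint A W, binomialWeight V p W = (1 - p) ^ A.card := by
  have hfilter : V.powerset.filter (Disjoint A) = (V \ A).powerset := by
    ext W
    simp only [Finset.mem_filter, Finset.mem_powerset, Finset.subset_sdiff, disjoint_comm]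
  have hfactor : ∀ W ∈ (V \ A).powerset, binomialWeight V p W =
      (1 - p) ^ A.card * binomialWeight (V \ A) p W := by
    intro W hW
    have hle := Finset.card_le_card (Finset.mem_powerset.1 hW)
    have hadd := Finset.card_sdiff_add_card_eq_card hA
    rw [binomialWeight, binomialWeight, mul_left_comm, ← pow_add]
    congr 2
    omega
  rw [hfilter, Finset.sum_congr rfl hfactor, ← Finset.mul_sum, sum_binomialWeight, mul_one]

theorem sum_binomialWeight_mul_card_disjoint [DecidableEq ι] (F : Finset E) {Δ : E → Finset ι}
    (hΔ : ∀ e ∈ F, Δ e ⊆ V) :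
    ∑ W ∈ V.powerset, binomialWeight V p W * (F.filter fun e => Disjoint (Δ e) W).card =
      ∑ e ∈ F, (1 - p) ^ (Δ e).card := by
  simp only [Finset.card_filter, Nat.cast_sum, Nat.cast_ite, Nat.cast_one, Nat.cast_zero,
    Finset.mul_sum, mul_ite, mul_one, mul_zero]
  rw [Finset.sum_comm]
  refine Finset.sum_congr rfl fun e he => ?_
  rw [← Finset.sum_filter, sum_binomialWeight_disjoint (hΔ e he)]

theorem sum_binomialWeight_mul_card (V : Finset ι) (p : ℝ) :
    ∑ W ∈ V.powerset, binomialWeight V p W * W.card = p * V.card := by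
  classical
  have hcompl : ∀ W ∈ V.powerset, binomialWeight V p W * W.card =
      binomialWeight V p W * V.card -
        binomialWeight V p W * (V.filter fun v => Disjoint {v} W).card := by
    intro W hW
    have hsub := Finset.mem_powerset.1 hW
    simp only [Finset.disjoint_singleton_left, Finset.filter_notMem_eq_sdiff]
    rw [Finset.cast_card_sdiff hsub]
    ring
  rw [Finset.sum_congr rfl hcompl, Finset.sum_sub_distrib, ← Finset.sum_mul, sum_binomialWeight,
    sum_binomialWeight_mul_card_disjoint V fun v hv => Finset.singleton_subset_iff.2 hv]
  simp only [Finset.card_singleton, pow_one, Finset.sum_const, nsmul_eq_mul]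
  ring

theorem exists_card_add_card_disjoint_le [DecidableEq ι] (F : Finset E) {Δ : E → Finset ι}
    (hΔ : ∀ e ∈ F, Δ e ⊆ V) (hp0 : 0 ≤ p) (hp1 : p ≤ 1) :
    ∃ W ⊆ V, (W.card : ℝ) + (F.filter fun e => Disjoint (Δ e) W).card ≤
      p * V.card + ∑ e ∈ F, (1 - p) ^ (Δ e).card := by
  have hweight (W : Finset ι) : 0 ≤ binomialWeight V p W :=
    mul_nonneg (pow_nonneg hp0 _) (pow_nonneg (sub_nonneg.2 hp1) _)
  obtain ⟨W₀, hW₀, hmin⟩ := Finset.exists_min_image V.powerset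
    (fun W => (W.card : ℝ) + (F.filter fun e => Disjoint (Δ e) W).card) ⟨∅, by simp⟩
  refine ⟨W₀, Finset.mem_powerset.1 hW₀, ?_⟩
  calc _ = ∑ W ∈ V.powerset, binomialWeight V p W *
          ((W₀.card : ℝ) + (F.filter fun e => Disjoint (Δ e) W₀).card) := by
        rw [← Finset.sum_mul, sum_binomialWeight, one_mul]
    _ ≤ ∑ W ∈ V.powerset, binomialWeight V p W *
          ((W.card : ℝ) + (F.filter fun e => Disjoint (Δ e) W).card) :=
        Finset.sum_le_sum fun W hW => mul_le_mul_of_nonneg_left (hmin W hW) (hweight W)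
    _ = _ := by
        simp only [mul_add, Finset.sum_add_distrib]
        rw [sum_binomialWeight_mul_card, sum_binomialWeight_mul_card_disjoint F hΔ]

-- Alteration: add one element of each `Δ e` missed by a random subset of `V` of density `p`.
theorem exists_hittingSet (F : Finset E) {Δ : E → Finset ι} (hne : ∀ e ∈ F, (Δ e).Nonempty)
    (hΔ : ∀ e ∈ F, Δ e ⊆ V) (hp0 : 0 ≤ p) (hp1 : p ≤ 1) :
    ∃ W ⊆ V, (∀ e ∈ F, ¬ Disjoint (Δ e) W) ∧
      (W.card : ℝ) ≤ p * V.card + ∑ e ∈ F, (1 - p) ^ (Δ e).card := by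
  classical
  obtain ⟨W₀, hW₀, hcard⟩ := exists_card_add_card_disjoint_le F hΔ hp0 hp1
  set M := F.filter fun e => Disjoint (Δ e) W₀
  have hpick : ∀ e ∈ F, ∃ P ⊆ Δ e, P.card = 1 := fun e he =>
    Finset.exists_subset_card_eq (hne e he).card_pos
  choose! P hP hP1 using hpick
  have hMF : M ⊆ F := Finset.filter_subset _ _
  refine ⟨W₀ ∪ M.biUnion P, Finset.union_subset hW₀ ?_, fun e he => ?_, hcard.trans' ?_⟩
  · exact Finset.biUnion_subset.2 fun e he => (hP e (hMF he)).trans (hΔ e (hMF he))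
  · by_cases hdisj : Disjoint (Δ e) W₀
    · obtain ⟨v, hv⟩ := Finset.card_pos.1 (Nat.one_pos.trans_eq (hP1 e he).symm)
      refine Finset.not_disjoint_iff.2 ⟨v, hP e he hv, Finset.mem_union_right _ ?_⟩
      exact Finset.mem_biUnion.2 ⟨e, Finset.mem_filter.2 ⟨he, hdisj⟩, hv⟩
    · exact fun h => hdisj (h.mono_right Finset.subset_union_left)
  · have hM : (M.biUnion P).card ≤ M.card * 1 :=
      Finset.card_biUnion_le_card_mul _ _ _ fun e he => (hP1 e (hMF he)).le
    exact_mod_cast (Finset.card_union_le _ _).trans (by omega)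

end HittingSet

section SparsePairs

theorem exp_neg_three_mul_le_sum {g : ℝ} {K : ℕ} (hg : 1 < g) (hgK : g ≤ K) :
    Real.exp (-(3 * g)) ≤
      ∑ k ∈ Finset.Ico 1 K, if g ≤ k + 1 then (1 / 8 : ℝ) ^ k else 0 := by
  obtain ⟨k, hk⟩ : ∃ k, ⌈g⌉₊ = k + 1 :=
    Nat.exists_eq_succ_of_ne_zero (Nat.ceil_pos.2 (by linarith)).ne'
  have hkg : (k : ℝ) < g := Nat.lt_ceil.1 (by omega)
  have hgk : g ≤ k + 1 := by exact_mod_cast hk ▸ Nat.le_ceil g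
  have hk1 : 1 ≤ k := by exact_mod_cast Nat.cast_pos.1 (by linarith : (0 : ℝ) < k)
  have hkK : k < K := by exact_mod_cast hkg.trans_le hgK
  have hexp : Real.exp (-3) ≤ 1 / 8 := by
    rw [Real.exp_neg, one_div]
    exact inv_anti₀ (by norm_num)
      (by linarith [Real.quadratic_le_exp_of_nonneg (x := 3) (by norm_num)])
  calc Real.exp (-(3 * g)) ≤ Real.exp (k * (-3)) := Real.exp_le_exp.2 (by linarith)
    _ ≤ (1 / 8) ^ k := by
      rw [Real.exp_nat_mul]
      gcongr
    _ = if g ≤ k + 1 then (1 / 8 : ℝ) ^ k else 0 := (if_pos hgk).symm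
    _ ≤ _ := Finset.single_le_sum
      (f := fun k : ℕ => if g ≤ k + 1 then (1 / 8 : ℝ) ^ k else 0)
      (fun k _ => by positivity) (Finset.mem_Ico.2 ⟨hk1, hkK⟩)

theorem sum_exp_neg_three_mul_le {E : Type*} (F : Finset E) {g : E → ℝ} {K m : ℕ}
    (hg : ∀ e ∈ F, 1 < g e) (hgK : ∀ e ∈ F, g e ≤ K)
    (hcount : ∀ k < K, (F.filter fun e => g e ≤ k + 1).card ≤ 4 ^ k * m) :
    ∑ e ∈ F, Real.exp (-(3 * g e)) ≤ m := by
  calc ∑ e ∈ F, Real.exp (-(3 * g e))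
      ≤ ∑ e ∈ F, ∑ k ∈ Finset.Ico 1 K, if g e ≤ k + 1 then (1 / 8 : ℝ) ^ k else 0 :=
        Finset.sum_le_sum fun e he => exp_neg_three_mul_le_sum (hg e he) (hgK e he)
    _ = ∑ k ∈ Finset.Ico 1 K, ((F.filter fun e => g e ≤ k + 1).card : ℝ) * (1 / 8) ^ k := by
        rw [Finset.sum_comm]
        simp only [← Finset.sum_filter, Finset.sum_const, nsmul_eq_mul]
    _ ≤ ∑ k ∈ Finset.Ico 1 K, (4 ^ k * m : ℝ) * (1 / 8) ^ k := by
        gcongr with k hk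
        exact_mod_cast hcount k (Finset.mem_Ico.1 hk).2
    _ = m * ∑ k ∈ Finset.Ico 1 K, (1 / 2 : ℝ) ^ k := by
        rw [Finset.mul_sum]
        refine Finset.sum_congr rfl fun k _ => ?_
        rw [mul_right_comm, ← mul_pow, mul_comm]
        norm_num
    _ ≤ m := by
        refine mul_le_of_le_one_right m.cast_nonneg ?_
        refine (geom_sum_Ico_le_of_lt_one (by norm_num) (by norm_num)).trans ?_
        norm_num

variable {ι X : Type*} [PseudoMetricSpace X]

/-- The points of the configuration `y` near `B` are sparse at the scales `δ, 2δ, …, Kδ`: the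
number of disjoint pairs at distance at most `(k + 1)δ` is below `4 ^ k * m`, and there are fewer
than `m` disjoint triples with two points within distance `Kδ` of the third. -/
structure IsSparse (B : Set X) (δ : ℝ) (K m : ℕ) (y : ι → X) : Prop where
  pairs : ∀ k < K, ¬ HasPacking (starPattern B ((k + 1) * δ) 1) y (4 ^ k * m)
  cherries : ¬ HasPacking (starPattern B (K * δ) 2) y m

theorem comp_cons_mem_starPattern {B : Set X} {d : ℝ} {s : ℕ} {y : ι → X} {i : ι}
    {v : Fin s → ι} :
    y ∘ Fin.cons i v ∈ starPattern B d s ↔ y i ∈ B ∧ ∀ b, dist (y (v b)) (y i) ≤ d := Iff.rfl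

theorem card_lt_of_not_hasPacking {B : Set X} {d : ℝ} {y : ι → X} {F : Finset (ι × ι)} {m : ℕ}
    (h : ¬ HasPacking (starPattern B d 1) y m) (hne : ∀ q ∈ F, q.1 ≠ q.2)
    (hB : ∀ q ∈ F, y q.1 ∈ B) (hd : ∀ q ∈ F, dist (y q.2) (y q.1) ≤ d)
    (hdisj : (F : Set (ι × ι)).Pairwise fun q q' => Disjoint ({q.1, q.2} : Set ι) {q'.1, q'.2}) :
    F.card < m := by
  classical
  let v : ι × ι → Fin 2 → ι := fun q => ![q.1, q.2]
  have hv : Function.Injective v := fun q q' h => Prod.ext (congrFun h 0) (congrFun h 1)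
  have hrange (q : ι × ι) : Set.range (v q) = {q.1, q.2} := Matrix.range_cons_cons_empty _ _ _
  have hpacking : IsPacking (starPattern B d 1) y (F.image v) := by
    refine ⟨Finset.forall_mem_image.2 fun q hq => injective_pair_iff_ne.2 (hne q hq),
      Finset.forall_mem_image.2 fun q hq => ?_, ?_⟩
    · refine comp_cons_mem_starPattern.2 ⟨hB q hq, fun b => ?_⟩
      rw [Subsingleton.elim b 0]
      exact hd q hq
    · rw [Finset.coe_image, Set.PairwiseDisjoint, hv.injOn.pairwise_image]
      simp only [← hrange] at hdisj
      exact hdisj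
  rw [← Finset.card_image_of_injective F hv]
  exact hpacking.card_lt h

theorem IsSparse.exists_exceptional_set [Finite ι] {B : Set X} {δ : ℝ} {K m : ℕ} {y : ι → X}
    (hK : 0 < K) (h : IsSparse B δ K m y) :
    ∃ U : Finset ι, U.card ≤ 5 * m ∧
      (∀ i j, y i ∈ B → i ∉ U → j ∉ U → i ≠ j → δ < dist (y j) (y i)) ∧
      ∀ i j k, y i ∈ B → i ∉ U → j ∉ U → k ∉ U → i ≠ j → i ≠ k →
        dist (y j) (y i) ≤ K * δ → dist (y k) (y i) ≤ K * δ → j = k := by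
  classical
  obtain ⟨U₁, hcard₁, hU₁⟩ := exists_cover_of_not_hasPacking (h.pairs 0 hK)
  obtain ⟨U₂, hcard₂, hU₂⟩ := exists_cover_of_not_hasPacking h.cherries
  rw [Fintype.card_fin] at hcard₁ hcard₂
  refine ⟨U₁ ∪ U₂, (Finset.card_union_le _ _).trans (by omega), ?_, ?_⟩
  · intro i j hB hi hj hij
    by_contra! hd
    obtain ⟨b, hb⟩ := hU₁ ![i, j] (injective_pair_iff_ne.2 hij)
      (comp_cons_mem_starPattern.2 ⟨hB, fun b => by simpa using hd⟩)
    fin_cases b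
    exacts [hi (Finset.mem_union_left _ hb), hj (Finset.mem_union_left _ hb)]
  · intro i j k hB hi hj hk hij hik hdj hdk
    by_contra hjk
    have hinj : Function.Injective ![i, j, k] :=
      Fin.cons_injective_iff.2 ⟨by simp [hij, hik], injective_pair_iff_ne.2 hjk⟩
    obtain ⟨b, hb⟩ := hU₂ ![i, j, k] hinj
      (comp_cons_mem_starPattern.2 ⟨hB, fun b => by fin_cases b; exacts [hdj, hdk]⟩)
    fin_cases b
    exacts [hi (Finset.mem_union_right _ hb), hj (Finset.mem_union_right _ hb),
      hk (Finset.mem_union_right _ hb)]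

variable [LinearOrder ι] {A : Finset ι} {B : Set X} {y : ι → X} {δ p : ℝ} {K m : ℕ}
  {Δ : ι → ι → Finset ι}

theorem pairwise_disjoint_closePairs {D : ℝ}
    (huniq : ∀ i ∈ A, ∀ j ∈ A, ∀ k ∈ A, i ≠ j → i ≠ k → dist (y j) (y i) ≤ D →
      dist (y k) (y i) ≤ D → j = k) :
    {q : ι × ι | q ∈ A ×ˢ A ∧ q.1 < q.2 ∧ dist (y q.2) (y q.1) ≤ D}.Pairwise
      fun q q' => Disjoint ({q.1, q.2} : Set ι) {q'.1, q'.2} := by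
  rintro ⟨a, b⟩ ⟨hab, hlt, hd⟩ ⟨a', b'⟩ ⟨hab', hlt', hd'⟩ hne
  obtain ⟨ha, hb⟩ := Finset.mem_product.1 hab
  obtain ⟨ha', hb'⟩ := Finset.mem_product.1 hab'
  have hswap := dist_comm (y b) (y a) ▸ hd
  have hswap' := dist_comm (y b') (y a') ▸ hd'
  simp only [Set.disjoint_insert_left, Set.disjoint_singleton_left, Set.mem_insert_iff,
    Set.mem_singleton_iff, not_or]
  refine ⟨⟨?_, ?_⟩, ?_, ?_⟩ <;> rintro rfl
  · exact hne (congrArg (Prod.mk a) (huniq _ ha _ hb _ hb' hlt.ne hlt'.ne hd hd'))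
  · exact (hlt.trans (huniq _ ha _ hb _ ha' hlt.ne hlt'.ne' hd hswap' ▸ hlt')).false
  · exact (hlt.trans (huniq _ hb _ ha _ hb' hlt.ne' hlt'.ne hswap hd' ▸ hlt')).false
  · exact hne (congrArg (·, b) (huniq _ hb _ ha _ ha' hlt.ne' hlt'.ne' hswap hswap'))

theorem IsSparse.sum_closePairs_le (h : IsSparse B δ K m y) (hδ : 0 < δ)
    (hAB : ∀ i ∈ A, y i ∈ B) (hsep : ∀ i ∈ A, ∀ j ∈ A, i ≠ j → δ < dist (y j) (y i))
    (huniq : ∀ i ∈ A, ∀ j ∈ A, ∀ k ∈ A, i ≠ j → i ≠ k → dist (y j) (y i) ≤ K * δ →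
      dist (y k) (y i) ≤ K * δ → j = k) :
    ∑ q ∈ A ×ˢ A with q.1 < q.2 ∧ dist (y q.2) (y q.1) ≤ K * δ,
      Real.exp (-(3 * (dist (y q.2) (y q.1) / δ))) ≤ m := by
  refine sum_exp_neg_three_mul_le (g := fun q : ι × ι => dist (y q.2) (y q.1) / δ) (K := K) _
    (fun q hq => ?_) (fun q hq => ?_) fun k hk => ?_
  · obtain ⟨hqA, hlt, -⟩ := Finset.mem_filter.1 hq
    obtain ⟨h₁, h₂⟩ := Finset.mem_product.1 hqA
    exact (one_lt_div hδ).2 (hsep _ h₁ _ h₂ hlt.ne)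
  · exact (div_le_iff₀ hδ).2 (Finset.mem_filter.1 hq).2.2
  · simp only [div_le_iff₀ hδ, Finset.filter_filter]
    refine (card_lt_of_not_hasPacking (h.pairs k hk) (fun q hq => ?_) (fun q hq => ?_)
      (fun q hq => ?_) ((pairwise_disjoint_closePairs huniq).mono fun q hq => ?_)).le
    all_goals obtain ⟨hqA, ⟨hlt, hdK⟩, hdk⟩ := Finset.mem_filter.1 hq
    exacts [hlt.ne, hAB _ (Finset.mem_product.1 hqA).1, hdk, ⟨hqA, hlt, hdK⟩]

theorem IsSparse.sum_pairs_le {ε : ℝ} (h : IsSparse B δ K m y) (hδ : 0 < δ) (hε : 0 ≤ ε)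
    (hAB : ∀ i ∈ A, y i ∈ B)
    (hsep : ∀ i ∈ A, ∀ j ∈ A, i ≠ j → δ < dist (y j) (y i))
    (huniq : ∀ i ∈ A, ∀ j ∈ A, ∀ k ∈ A, i ≠ j → i ≠ k → dist (y j) (y i) ≤ K * δ →
      dist (y k) (y i) ≤ K * δ → j = k)
    (hnear : ∀ i ∈ A, ∀ j ∈ A, δ < dist (y j) (y i) → dist (y j) (y i) ≤ K * δ →
      (1 - p) ^ (Δ i j).card ≤ Real.exp (-(3 * (dist (y j) (y i) / δ))))
    (hfar : ∀ i ∈ A, ∀ j ∈ A, K * δ < dist (y j) (y i) → (1 - p) ^ (Δ i j).card ≤ ε) :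
    ∑ q ∈ A ×ˢ A with q.1 < q.2, (1 - p) ^ (Δ q.1 q.2).card ≤ m + A.card ^ 2 * ε := by
  rw [← Finset.sum_filter_add_sum_filter_not _ fun q => dist (y q.2) (y q.1) ≤ K * δ,
    Finset.filter_filter]
  refine add_le_add ((Finset.sum_le_sum fun q hq => ?_).trans
    (h.sum_closePairs_le hδ hAB hsep huniq)) ?_
  · obtain ⟨hqA, hlt, hd⟩ := Finset.mem_filter.1 hq
    obtain ⟨h₁, h₂⟩ := Finset.mem_product.1 hqA
    exact hnear _ h₁ _ h₂ (hsep _ h₁ _ h₂ hlt.ne) hd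
  · set F := ((A ×ˢ A).filter fun q => q.1 < q.2).filter fun q => ¬ dist (y q.2) (y q.1) ≤ K * δ
    have hcard : F.card ≤ A.card ^ 2 :=
      (Finset.card_filter_le _ _).trans <| (Finset.card_filter_le _ _).trans_eq <| by
        rw [Finset.card_product, sq]
    calc _ ≤ F.card • ε := Finset.sum_le_card_nsmul _ _ _ fun q hq => by
          obtain ⟨hqF, hd⟩ := Finset.mem_filter.1 hq
          obtain ⟨h₁, h₂⟩ := Finset.mem_product.1 (Finset.mem_filter.1 hqF).1
          exact hfar _ h₁ _ h₂ (not_le.1 hd)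
      _ ≤ A.card ^ 2 * ε := by
          rw [nsmul_eq_mul]
          gcongr
          exact_mod_cast hcard

-- The close pairs form a matching, so that few of the sets `Δ i j` are small.
theorem IsSparse.exists_pairHittingSet_of_separated {V : Finset ι} {ε : ℝ}
    (h : IsSparse B δ K m y) (hδ : 0 < δ) (hp0 : 0 ≤ p) (hp1 : p ≤ 1) (hε : 0 ≤ ε)
    (hAB : ∀ i ∈ A, y i ∈ B)
    (hsep : ∀ i ∈ A, ∀ j ∈ A, i ≠ j → δ < dist (y j) (y i))
    (huniq : ∀ i ∈ A, ∀ j ∈ A, ∀ k ∈ A, i ≠ j → i ≠ k → dist (y j) (y i) ≤ K * δ →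
      dist (y k) (y i) ≤ K * δ → j = k)
    (hne : ∀ i ∈ A, ∀ j ∈ A, (Δ i j).Nonempty) (hΔ : ∀ i ∈ A, ∀ j ∈ A, Δ i j ⊆ V)
    (hnear : ∀ i ∈ A, ∀ j ∈ A, δ < dist (y j) (y i) → dist (y j) (y i) ≤ K * δ →
      (1 - p) ^ (Δ i j).card ≤ Real.exp (-(3 * (dist (y j) (y i) / δ))))
    (hfar : ∀ i ∈ A, ∀ j ∈ A, K * δ < dist (y j) (y i) → (1 - p) ^ (Δ i j).card ≤ ε) :
    ∃ W ⊆ V, (W.card : ℝ) ≤ p * V.card + m + A.card ^ 2 * ε ∧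
      ∀ i ∈ A, ∀ j ∈ A, i < j → ¬ Disjoint (Δ i j) W := by
  have hmem : ∀ q ∈ (A ×ˢ A).filter fun q => q.1 < q.2, q.1 ∈ A ∧ q.2 ∈ A := fun q hq =>
    Finset.mem_product.1 (Finset.mem_filter.1 hq).1
  obtain ⟨W, hWV, hW, hcard⟩ := exists_hittingSet (V := V) _ (Δ := fun q => Δ q.1 q.2)
    (fun q hq => hne _ (hmem q hq).1 _ (hmem q hq).2)
    (fun q hq => hΔ _ (hmem q hq).1 _ (hmem q hq).2) hp0 hp1
  refine ⟨W, hWV, ?_, fun i hi j hj hij =>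
    hW (i, j) (Finset.mem_filter.2 ⟨Finset.mem_product.2 ⟨hi, hj⟩, hij⟩)⟩
  linarith [h.sum_pairs_le hδ hε hAB hsep huniq hnear hfar]

-- Exceptional points become sensors.
theorem IsSparse.exists_pairHittingSet [Finite ι] {V : Finset ι} {ε : ℝ} (h : IsSparse B δ K m y)
    (hδ : 0 < δ) (hK : 0 < K) (hp0 : 0 ≤ p) (hp1 : p ≤ 1) (hε : 0 ≤ ε) (hAV : A ⊆ V)
    (hAB : ∀ i ∈ A, y i ∈ B) (hΔ : ∀ i ∈ A, ∀ j ∈ A, i ∈ Δ i j ∧ j ∈ Δ i j ∧ Δ i j ⊆ V)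
    (hnear : ∀ i ∈ A, ∀ j ∈ A, δ < dist (y j) (y i) → dist (y j) (y i) ≤ K * δ →
      (1 - p) ^ (Δ i j).card ≤ Real.exp (-(3 * (dist (y j) (y i) / δ))))
    (hfar : ∀ i ∈ A, ∀ j ∈ A, K * δ < dist (y j) (y i) → (1 - p) ^ (Δ i j).card ≤ ε) :
    ∃ W ⊆ V, (W.card : ℝ) ≤ p * V.card + 6 * m + A.card ^ 2 * ε ∧
      ∀ i ∈ A, ∀ j ∈ A, i < j → ¬ Disjoint (Δ i j) W := by
  obtain ⟨U, hU, hsep, huniq⟩ := h.exists_exceptional_set hK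
  have hmem : ∀ i ∈ A \ U, i ∈ A ∧ i ∉ U := fun i hi => Finset.mem_sdiff.1 hi
  obtain ⟨W, hWV, hcard, hW⟩ := h.exists_pairHittingSet_of_separated (A := A \ U) (Δ := Δ) (V := V)
    hδ hp0 hp1 hε (fun i hi => hAB i (hmem i hi).1)
    (fun i hi j hj => hsep i j (hAB i (hmem i hi).1) (hmem i hi).2 (hmem j hj).2)
    (fun i hi j hj k hk =>
      huniq i j k (hAB i (hmem i hi).1) (hmem i hi).2 (hmem j hj).2 (hmem k hk).2)
    (fun i hi j hj => ⟨i, (hΔ i (hmem i hi).1 j (hmem j hj).1).1⟩)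
    (fun i hi j hj => (hΔ i (hmem i hi).1 j (hmem j hj).1).2.2)
    (fun i hi j hj => hnear i (hmem i hi).1 j (hmem j hj).1)
    (fun i hi j hj => hfar i (hmem i hi).1 j (hmem j hj).1)
  refine ⟨W ∪ (A ∩ U), Finset.union_subset hWV (Finset.inter_subset_left.trans hAV), ?_,
    fun i hi j hj hij hdisj => ?_⟩
  · have hunion : ((W ∪ (A ∩ U)).card : ℝ) ≤ W.card + 5 * m := by
      exact_mod_cast (Finset.card_union_le _ _).trans
        (Nat.add_le_add_left ((Finset.card_le_card Finset.inter_subset_right).trans hU) _)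
    have hmono : ((A \ U).card : ℝ) ^ 2 * ε ≤ A.card ^ 2 * ε := by
      gcongr
      exact Finset.sdiff_subset
    linarith
  · obtain ⟨hiΔ, hjΔ, -⟩ := hΔ i hi j hj
    rw [Finset.disjoint_union_right] at hdisj
    have hout : ∀ k ∈ A, k ∈ Δ i j → k ∈ A \ U := fun k hk hkΔ => Finset.mem_sdiff.2
      ⟨hk, fun hkU => Finset.disjoint_left.1 hdisj.2 hkΔ (Finset.mem_inter.2 ⟨hk, hkU⟩)⟩
    exact hW i (hout i hi hiΔ) j (hout j hj hjΔ) hij hdisj.1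

end SparsePairs

section Reduction

variable {n : ℕ}

/-- At most `w` sensors in the square of side `10⁵ r` around `c` distinguish the vertices in its
internal square. -/
def HasSensors (r w : ℝ) (x : Fin n → ℝ × ℝ) (c : SupTorus √(n : ℝ)) : Prop :=
  ∃ W ⊆ hits (Metric.closedBall c (5 * 10 ^ 4 * r)) (toSupTorus n ∘ x), (W.card : ℝ) ≤ w ∧
    Distinguishes (torusGraph r x) W
      (hits (Metric.closedBall c (5 * 10 ^ 4 * r - r)) (toSupTorus n ∘ x))

/-- The configurations for which every square of the family has at most `w` sensors that distinguish
the vertices in its internal square. -/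
def localizable (n : ℕ) (r w : ℝ) : Set (Fin n → ℝ × ℝ) :=
  {x | ∀ S ∈ squareFamily n r, ∃ W : Finset (Fin n), (W : Set (Fin n)) ⊆ verticesIn x S ∧
    (W.card : ℝ) ≤ w ∧ Distinguishes (torusGraph r x) W (verticesIn x (S.internal r))}

theorem localizable_mono {r w w' : ℝ} (hw : w ≤ w') : localizable n r w ⊆ localizable n r w' :=
  fun _ hx S hS =>
    let ⟨W, hWS, hcard, hW⟩ := hx S hS
    ⟨W, hWS, hcard.trans hw, hW⟩

theorem mem_localizable {r w : ℝ} {x : Fin n → ℝ × ℝ}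
    (hx : ∀ i j : ℕ, 10 ^ 4 * r * i < √(n : ℝ) → 10 ^ 4 * r * j < √(n : ℝ) →
      HasSensors r w x (toSupTorus n
        (10 ^ 4 * r * i + 10 ^ 5 * r / 2, 10 ^ 4 * r * j + 10 ^ 5 * r / 2))) :
    x ∈ localizable n r w := by
  rintro S ⟨i, j, hi, hj, rfl⟩
  have hinternal (a : ℝ) : a + r + (10 ^ 5 * r - 2 * r) / 2 = a + 10 ^ 5 * r / 2 := by ring
  have hhalf : 10 ^ 5 * r / 2 = 5 * 10 ^ 4 * r := by ring
  have hhalf' : (10 ^ 5 * r - 2 * r) / 2 = 5 * 10 ^ 4 * r - r := by ring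
  obtain ⟨W, hWc, hcard, hW⟩ := hx i j hi hj
  refine ⟨W, fun k hk => mem_verticesIn_iff.2 ?_, hcard,
    fun k hk l hl => hW (mem_hits.2 ?_) (mem_hits.2 ?_)⟩
  · have hkc := mem_hits.1 (hWc hk)
    rwa [← hhalf] at hkc
  · rwa [mem_verticesIn_iff, Square.internal, hinternal, hinternal, hhalf'] at hk
  · rwa [mem_verticesIn_iff, Square.internal, hinternal, hinternal, hhalf'] at hl

theorem lt_of_mul_lt_sqrt {a : ℝ} (ha : 1 ≤ a) {i : ℕ} (hi : a * i < √(n : ℝ)) : i < n := by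
  have hn : (1 : ℝ) ≤ n := by
    have hpos : (0 : ℝ) < n := Real.sqrt_pos.1 ((by positivity : 0 ≤ a * i).trans_lt hi)
    exact_mod_cast hpos
  have hsqrt : √(n : ℝ) ≤ n := Real.sqrt_le_iff.2 ⟨n.cast_nonneg, by nlinarith⟩
  exact_mod_cast ((le_mul_of_one_le_left i.cast_nonneg ha).trans_lt hi).trans_le hsqrt

theorem one_sub_le_pointsLaw_localizable [Fact (0 < √(n : ℝ))] {r w b : ℝ} (hr : 1 ≤ r)
    {bad : SupTorus √(n : ℝ) → Set (Fin n → SupTorus √(n : ℝ))}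
    (hbad : ∀ c, (Measure.pi fun _ => torusLaw n).real (bad c) ≤ b)
    (hgood : ∀ (x : Fin n → ℝ × ℝ) c, toSupTorus n ∘ x ∉ bad c → HasSensors r w x c) :
    1 - ENNReal.ofReal (n ^ 2 * b) ≤ pointsLaw n (localizable n r w) := by
  have hb : 0 ≤ b := measureReal_nonneg.trans (hbad 0)
  let centre (q : ℕ × ℕ) : SupTorus √(n : ℝ) :=
    toSupTorus n (10 ^ 4 * r * q.1 + 10 ^ 5 * r / 2, 10 ^ 4 * r * q.2 + 10 ^ 5 * r / 2)
  let grid := Finset.range n ×ˢ Finset.range n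
  have hcompl : (localizable n r w)ᶜ ⊆
      (toSupTorus n ∘ ·) ⁻¹' ⋃ q ∈ grid, bad (centre q) := by
    refine Set.compl_subset_comm.1 fun x hx => mem_localizable fun i j hi hj =>
      hgood x _ fun h => hx (Set.mem_biUnion (x := (i, j)) ?_ h)
    have hscale : 1 ≤ 10 ^ 4 * r := by linarith
    exact Finset.mk_mem_product (Finset.mem_range.2 (lt_of_mul_lt_sqrt hscale hi))
      (Finset.mem_range.2 (lt_of_mul_lt_sqrt hscale hj))
  have hunion : (Measure.pi fun _ => torusLaw n).real (⋃ q ∈ grid, bad (centre q)) ≤ n ^ 2 * b :=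
    calc _ ≤ ∑ q ∈ grid, (Measure.pi fun _ => torusLaw n).real (bad (centre q)) :=
          measureReal_biUnion_finset_le _ _
      _ ≤ grid.card • b := Finset.sum_le_card_nsmul _ _ _ fun q _ => hbad _
      _ = n ^ 2 * b := by
          rw [Finset.card_product, Finset.card_range, nsmul_eq_mul, Nat.cast_mul, sq]
  rw [tsub_le_iff_right, ← measure_univ (μ := pointsLaw n)]
  calc pointsLaw n Set.univ
      ≤ pointsLaw n (localizable n r w) + pointsLaw n (localizable n r w)ᶜ :=
        measure_univ_le_add_compl _
    _ ≤ pointsLaw n (localizable n r w) + ENNReal.ofReal (n ^ 2 * b) := by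
        gcongr
        refine (measure_mono hcompl).trans
          ((measurePreserving_toSupTorus_comp.measure_preimage_le _).trans ?_)
        exact (ENNReal.le_ofReal_iff_toReal_le (measure_ne_top _ _) (by positivity)).2 hunion

end Reduction

section Sensors

variable {n : ℕ}

theorem distinguishes_of_not_disjoint_separators {x : Fin n → ℝ × ℝ} {r : ℝ} {W : Finset (Fin n)}
    {A : Finset (Fin n)} (h : ∀ i ∈ A, ∀ j ∈ A, i < j →
      ¬Disjoint (separators (discSymmDiff √(n : ℝ) r) (toSupTorus n ∘ x) i j) W) :
    Distinguishes (torusGraph r x) W A := by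
  have hlt : ∀ i ∈ A, ∀ j ∈ A, i < j →
      signature (torusGraph r x) W i ≠ signature (torusGraph r x) W j := by
    intro i hi j hj hij heq
    obtain ⟨k, hk, hkW⟩ := Finset.not_disjoint_iff.1 (h i hi j hj hij)
    have hkij : (torusGraph r x).edist k i = (torusGraph r x).edist k j := congrFun heq ⟨k, hkW⟩
    rcases eq_or_ne k i with rfl | hki
    · rw [SimpleGraph.edist_self, eq_comm, SimpleGraph.edist_eq_zero_iff] at hkij
      exact hij.ne hkij
    rcases eq_or_ne k j with rfl | hkj
    · rw [SimpleGraph.edist_self, SimpleGraph.edist_eq_zero_iff] at hkij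
      exact hij.ne' hkij
    have hadj : (torusGraph r x).Adj k i ↔ (torusGraph r x).Adj k j := by
      rw [← SimpleGraph.edist_eq_one_iff_adj, ← SimpleGraph.edist_eq_one_iff_adj, hkij]
    have hdist : euclDist (toSupTorus n (x i)) (toSupTorus n (x k)) ≤ r ↔
        euclDist (toSupTorus n (x j)) (toSupTorus n (x k)) ≤ r := by
      simpa only [torusGraph, ne_eq, hki, hkj, not_false_eq_true, true_and, torusDist_eq_euclDist,
        euclDist_comm (toSupTorus n (x k))] using hadj
    exact ((mem_separators.1 hk).resolve_left hki).resolve_left hkj hdist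
  intro i hi j hj heq
  rcases lt_trichotomy i j with hij | hij | hij
  · exact absurd heq (hlt i hi j hj hij)
  · exact hij
  · exact absurd heq.symm (hlt j hj i hi hij)

theorem mem_closedBall_of_mem_separators {L r ρ : ℝ} (hr : 0 ≤ r)
    {ι : Type*} [Fintype ι] {y : ι → SupTorus L} {c : SupTorus L} {i j k : ι}
    (hi : y i ∈ Metric.closedBall c (ρ - r)) (hj : y j ∈ Metric.closedBall c (ρ - r))
    (hk : k ∈ separators (discSymmDiff L r) y i j) : y k ∈ Metric.closedBall c ρ := by
  have hnear {l : ι} (hl : y l ∈ Metric.closedBall c (ρ - r)) (hlk : euclDist (y l) (y k) ≤ r) :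
      y k ∈ Metric.closedBall c ρ := by
    rw [Metric.mem_closedBall] at hl ⊢
    linarith [dist_triangle_left (y k) c (y l), dist_le_euclDist (y l) (y k)]
  have hsub : Metric.closedBall c (ρ - r) ⊆ Metric.closedBall c ρ :=
    Metric.closedBall_subset_closedBall (by linarith)
  rcases mem_separators.1 hk with rfl | rfl | hk
  · exact hsub hi
  · exact hsub hj
  · rcases (xor_iff_not_iff _ _).2 hk with hk | hk
    exacts [hnear hi hk.1, hnear hj hk.1]

end Sensors

section Typical

/-- The properties of a configuration near the centre `c` of a square of side `10⁵ r` that make the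
vertices of the square distinguishable with `O(l²)` sensors. The threshold `10 * l / r` is the
distance beyond which a pair of points is expected to have at least `10 * l` separators. -/
structure IsTypical {ι : Type*} [Fintype ι] {L : ℝ} (r l : ℝ) (K m : ℕ) (c : SupTorus L)
    (y : ι → SupTorus L) : Prop where
  card_lt : (hitCount (Metric.closedBall c (5 * 10 ^ 4 * r)) y : ℝ) < 2 * (10 ^ 10 * r ^ 2)
  sparse : IsSparse (Metric.closedBall c (5 * 10 ^ 4 * r)) (10 * l / r) K m y
  lt_card_separators : ∀ i j, i ≠ j → 10 * l ≤ r * min (dist (y i) (y j)) r →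
    r * min (dist (y i) (y j)) r / 20 < (separators (discSymmDiff L r) y i j).card

theorem half_pow_le_exp {l : ℝ} (hl : 10 ≤ l) {m : ℕ} (hm : l ^ 2 ≤ m) :
    (1 / 2 : ℝ) ^ m ≤ Real.exp (-(5 * l)) := by
  calc (1 / 2 : ℝ) ^ m ≤ Real.exp (-(1 / 2)) ^ m := by
        gcongr
        linarith [Real.add_one_le_exp (-(1 / 2) : ℝ)]
    _ = Real.exp (m * -(1 / 2)) := by rw [Real.exp_nat_mul]
    _ ≤ Real.exp (-(5 * l)) := Real.exp_le_exp.2 (by nlinarith)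

theorem sq_succ_le_four_pow (k : ℕ) : (k + 1) ^ 2 ≤ 4 ^ k := by
  calc (k + 1) ^ 2 ≤ (2 ^ k) ^ 2 := by
        gcongr
        exact Nat.lt_two_pow_self
    _ = 4 ^ k := by rw [← pow_mul, mul_comm, pow_mul]; norm_num

variable {n : ℕ} [hL : Fact (0 < √(n : ℝ))]

theorem mul_torusLawReal_closedBall_le (c : SupTorus √(n : ℝ)) {ρ : ℝ} (hρ : 0 ≤ ρ) :
    Fintype.card (Fin n) * (torusLaw n).real (Metric.closedBall c ρ) ≤ 4 * ρ ^ 2 := by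
  rw [Fintype.card_fin, mul_torusLawReal]
  exact volumeReal_closedBall_le c hρ

theorem measureReal_crowded_le (c : SupTorus √(n : ℝ)) {r : ℝ} (hr : 0 ≤ r) :
    (Measure.pi fun _ : Fin n => torusLaw n).real
      {y | 2 * (10 ^ 10 * r ^ 2) ≤ hitCount (Metric.closedBall c (5 * 10 ^ 4 * r)) y} ≤
      Real.exp (-(10 ^ 10 * r ^ 2 / 4)) :=
  measureReal_two_mul_le_hitCount_le _ Metric.isClosed_closedBall.measurableSet
    ((mul_torusLawReal_closedBall_le c (by positivity)).trans_eq (by ring))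

theorem measureReal_hasPacking_closedBall_le (c : SupTorus √(n : ℝ)) {ρ d : ℝ} (hρ : 0 ≤ ρ)
    (hd : 0 ≤ d) {s m : ℕ} (hm : 6 * (4 * ρ ^ 2 * (4 * d ^ 2) ^ s) ≤ m) :
    (Measure.pi fun _ : Fin n => torusLaw n).real
      {y | HasPacking (starPattern (Metric.closedBall c ρ) d s) y m} ≤ (1 / 2) ^ m :=
  measureReal_hasPacking_starPattern_le _ Metric.isClosed_closedBall.measurableSet
    (mul_torusLawReal_closedBall_le c hρ) (fun u => mul_torusLawReal_closedBall_le u hd) hm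

theorem measureReal_not_isSparse_le (c : SupTorus √(n : ℝ)) {ρ δ : ℝ} (hρ : 0 ≤ ρ) (hδ : 0 ≤ δ)
    {K m : ℕ} (hK : 2 * K ^ 2 * δ ≤ 1) (hm : 96 * ρ ^ 2 * δ ^ 2 ≤ m) :
    (Measure.pi fun _ : Fin n => torusLaw n).real
      {y | ¬ IsSparse (Metric.closedBall c ρ) δ K m y} ≤ (K + 1) * (1 / 2) ^ m := by
  set μ := Measure.pi fun _ : Fin n => torusLaw n
  have hpairs (k : ℕ) : μ.real {y | HasPacking (starPattern (Metric.closedBall c ρ)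
      ((k + 1) * δ) 1) y (4 ^ k * m)} ≤ (1 / 2) ^ m := by
    have hk : ((k : ℝ) + 1) ^ 2 ≤ 4 ^ k := by exact_mod_cast sq_succ_le_four_pow k
    refine (measureReal_hasPacking_closedBall_le c hρ (by positivity) ?_).trans
      (pow_le_pow_of_le_one (by norm_num) (by norm_num)
        (Nat.le_mul_of_pos_left m (by positivity)))
    calc 6 * (4 * ρ ^ 2 * (4 * ((k + 1) * δ) ^ 2) ^ 1)
        = (k + 1) ^ 2 * (96 * ρ ^ 2 * δ ^ 2) := by ring
      _ ≤ (4 ^ k * m : ℝ) := by gcongr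
      _ = ((4 ^ k * m : ℕ) : ℝ) := by push_cast; ring
  have hcherries : μ.real {y | HasPacking (starPattern (Metric.closedBall c ρ) (K * δ) 2) y m} ≤
      (1 / 2) ^ m := by
    refine measureReal_hasPacking_closedBall_le c hρ (by positivity) (le_trans ?_ hm)
    calc 6 * (4 * ρ ^ 2 * (4 * (K * δ) ^ 2) ^ 2)
        = 96 * ρ ^ 2 * δ ^ 2 * (2 * K ^ 2 * δ) ^ 2 := by ring
      _ ≤ 96 * ρ ^ 2 * δ ^ 2 * 1 := by
          gcongr
          exact pow_le_one₀ (by positivity) hK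
      _ = 96 * ρ ^ 2 * δ ^ 2 := mul_one _
  have hsub : {y | ¬ IsSparse (Metric.closedBall c ρ) δ K m y} ⊆
      (⋃ k ∈ Finset.range K, {y : Fin n → SupTorus √(n : ℝ) |
        HasPacking (starPattern (Metric.closedBall c ρ) ((k + 1) * δ) 1) y (4 ^ k * m)}) ∪
      {y | HasPacking (starPattern (Metric.closedBall c ρ) (K * δ) 2) y m} := by
    refine fun y => not_imp_comm.1 fun hy => ?_
    simp only [Set.mem_union, Set.mem_iUnion, Finset.mem_range, not_or, not_exists] at hy
    exact ⟨hy.1, hy.2⟩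
  calc μ.real {y | ¬ IsSparse (Metric.closedBall c ρ) δ K m y}
      ≤ (∑ _k ∈ Finset.range K, (1 / 2 : ℝ) ^ m) + (1 / 2) ^ m :=
        (measureReal_mono hsub).trans ((measureReal_union_le _ _).trans (add_le_add
          ((measureReal_biUnion_finset_le _ _).trans (Finset.sum_le_sum fun k _ => hpairs k))
          hcherries))
    _ = (K + 1) * (1 / 2) ^ m := by
        rw [Finset.sum_const, Finset.card_range, nsmul_eq_mul, add_one_mul]

theorem measureReal_exists_few_separators_le (hn : 12 ≤ n) {r l : ℝ} (hr : 0 ≤ r)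
    (hrn : r ≤ √(n : ℝ) / 4) (hl : 0 ≤ l) :
    (Measure.pi fun _ : Fin n => torusLaw n).real
      {y | ∃ i j, i ≠ j ∧ 10 * l ≤ r * min (dist (y i) (y j)) r ∧
        ((separators (discSymmDiff √(n : ℝ) r) y i j).card : ℝ) ≤
          r * min (dist (y i) (y j)) r / 20} ≤ n ^ 2 * Real.exp (-(5 * l)) := by
  have hf : Measurable fun q : SupTorus √(n : ℝ) × SupTorus √(n : ℝ) =>
      r * min (dist q.1 q.2) r :=
    (continuous_const.mul (continuous_dist.min continuous_const)).measurable
  refine (measureReal_exists_card_separators_le (torusLaw n) (measurableSet_discSymmDiff _ r) hf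
    (fun q => ?_) (by positivity)).trans_eq ?_
  · rw [Fintype.card_fin]
    exact mul_min_dist_le_torusLawReal_discSymmDiff hn hr hrn q
  · rw [Fintype.card_fin]
    ring_nf

theorem measureReal_not_isTypical_le (hn : 12 ≤ n) {r l : ℝ} (hl : 10 ≤ l) (hlr : l ≤ r)
    (hrn : r ≤ √(n : ℝ) / 4) {K m : ℕ} (hK : 20 * K ^ 2 * l ≤ r)
    (hm : 24 * 10 ^ 12 * l ^ 2 ≤ m) (c : SupTorus √(n : ℝ)) :
    (Measure.pi fun _ : Fin n => torusLaw n).real {y | ¬ IsTypical r l K m c y} ≤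
      (K + 2 + n ^ 2) * Real.exp (-(5 * l)) := by
  set μ := Measure.pi fun _ : Fin n => torusLaw n
  have hr : 0 < r := by linarith
  have hcrowded : μ.real {y | 2 * (10 ^ 10 * r ^ 2) ≤
      hitCount (Metric.closedBall c (5 * 10 ^ 4 * r)) y} ≤ Real.exp (-(5 * l)) :=
    (measureReal_crowded_le c hr.le).trans (Real.exp_le_exp.2 (by nlinarith))
  have hsparse : μ.real {y | ¬ IsSparse (Metric.closedBall c (5 * 10 ^ 4 * r)) (10 * l / r) K m y} ≤
      (K + 1) * Real.exp (-(5 * l)) := by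
    refine (measureReal_not_isSparse_le c (by positivity) (by positivity) ?_ ?_).trans ?_
    · rw [← mul_div_assoc, div_le_one hr]
      linarith
    · refine hm.trans' (le_of_eq ?_)
      field_simp
      ring
    · gcongr
      exact half_pow_le_exp hl (hm.trans' (by nlinarith))
  have hsub : {y | ¬ IsTypical r l K m c y} ⊆
      {y : Fin n → SupTorus √(n : ℝ) | 2 * (10 ^ 10 * r ^ 2) ≤
        hitCount (Metric.closedBall c (5 * 10 ^ 4 * r)) y} ∪
      {y | ¬ IsSparse (Metric.closedBall c (5 * 10 ^ 4 * r)) (10 * l / r) K m y} ∪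
      {y | ∃ i j, i ≠ j ∧ 10 * l ≤ r * min (dist (y i) (y j)) r ∧
        ((separators (discSymmDiff √(n : ℝ) r) y i j).card : ℝ) ≤
          r * min (dist (y i) (y j)) r / 20} := by
    refine fun y => not_imp_comm.1 fun hy => ?_
    simp only [Set.mem_union, Set.mem_ofPred_eq, not_or, not_le, not_not] at hy
    exact ⟨hy.1.1, hy.1.2, fun i j hij hlij => not_le.1 fun h => hy.2 ⟨i, j, hij, hlij, h⟩⟩
  calc μ.real {y | ¬ IsTypical r l K m c y}
      ≤ Real.exp (-(5 * l)) + (K + 1) * Real.exp (-(5 * l)) + n ^ 2 * Real.exp (-(5 * l)) :=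
        (measureReal_mono hsub).trans ((measureReal_union_le _ _).trans (add_le_add
          ((measureReal_union_le _ _).trans (add_le_add hcrowded hsparse))
          (measureReal_exists_few_separators_le hn hr.le hrn (by positivity))))
    _ = (K + 2 + n ^ 2) * Real.exp (-(5 * l)) := by ring

end Typical

section SparseSensors

theorem one_sub_pow_le_exp {p : ℝ} (hp : p ≤ 1) (N : ℕ) :
    (1 - p) ^ N ≤ Real.exp (-(p * N)) := by
  calc (1 - p) ^ N ≤ Real.exp (-p) ^ N :=
        pow_le_pow_left₀ (sub_nonneg.2 hp) (Real.one_sub_le_exp_neg p) N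
    _ = Real.exp (-(p * N)) := by
        rw [← Real.exp_nat_mul]
        ring_nf

variable {r l : ℝ} {K m : ℕ}

theorem IsTypical.one_sub_pow_card_separators_le {ι : Type*} [Fintype ι] {L : ℝ} {c : SupTorus L}
    {y : ι → SupTorus L} (h : IsTypical r l K m c y) (hl : 0 < l) (hlr : 100 * l ≤ r) {g : ℝ}
    (hg : 1 ≤ g) (hgr : g * (10 * l / r) ≤ r) {i j : ι}
    (hij : g * (10 * l / r) ≤ dist (y j) (y i)) :
    (1 - 10 ^ 4 * l ^ 2 / r ^ 2) ^ (separators (discSymmDiff L r) y i j).card ≤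
      Real.exp (-(5000 * g * (l ^ 3 / r ^ 2))) := by
  have hr : 0 < r := by linarith
  have hne : i ≠ j := by
    rintro rfl
    rw [dist_self] at hij
    exact hij.not_gt (by positivity)
  have hmean : 10 * l * g ≤ r * min (dist (y i) (y j)) r :=
    calc 10 * l * g = r * (g * (10 * l / r)) := by field_simp
      _ ≤ r * min (dist (y i) (y j)) r := by
        gcongr
        exact le_min (dist_comm (y j) (y i) ▸ hij) hgr
  have hcard : l * g / 2 ≤ (separators (discSymmDiff L r) y i j).card := by
    have hlmean := (le_mul_of_one_le_right (by positivity) hg).trans hmean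
    linarith [h.lt_card_separators i j hne hlmean]
  have hp : 10 ^ 4 * l ^ 2 / r ^ 2 ≤ 1 := by
    rw [div_le_one (by positivity)]
    nlinarith
  refine (one_sub_pow_le_exp hp _).trans (Real.exp_le_exp.2 (neg_le_neg ?_))
  calc 5000 * g * (l ^ 3 / r ^ 2) = 10 ^ 4 * l ^ 2 / r ^ 2 * (l * g / 2) := by ring
    _ ≤ _ := by gcongr

theorem IsTypical.exists_hittingSet {ι : Type*} [Fintype ι] [LinearOrder ι] {L : ℝ}
    {c : SupTorus L} {y : ι → SupTorus L} (h : IsTypical r l K m c y) (hl : 0 < l)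
    (hlr : 100 * l ≤ r) (hrl : r ^ 2 ≤ l ^ 3) (hK : 0 < K) (hKr : K * (10 * l / r) ≤ r)
    {A V : Finset ι} (hA : ∀ i ∈ A, y i ∈ Metric.closedBall c (5 * 10 ^ 4 * r - r))
    (hV : ∀ i, i ∈ V ↔ y i ∈ Metric.closedBall c (5 * 10 ^ 4 * r)) :
    ∃ W ⊆ V, (W.card : ℝ) ≤ 10 ^ 4 * l ^ 2 / r ^ 2 * V.card + 6 * m +
        A.card ^ 2 * Real.exp (-(5000 * K * (l ^ 3 / r ^ 2))) ∧
      ∀ i ∈ A, ∀ j ∈ A, i < j → ¬Disjoint (separators (discSymmDiff L r) y i j) W := by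
  have hr : 0 < r := by linarith
  have hratio : 1 ≤ l ^ 3 / r ^ 2 := (one_le_div (by positivity)).2 hrl
  have hδ : 0 < 10 * l / r := by positivity
  have hball (i : ι) (hi : i ∈ A) : y i ∈ Metric.closedBall c (5 * 10 ^ 4 * r) :=
    Metric.closedBall_subset_closedBall (by linarith) (hA i hi)
  refine h.sparse.exists_pairHittingSet hδ hK (by positivity)
    ((div_le_one (by positivity)).2 (by nlinarith)) (Real.exp_nonneg _)
    (fun i hi => (hV i).2 (hball i hi)) hball
    (fun i hi j hj => ⟨mem_separators.2 (.inl rfl), mem_separators.2 (.inr (.inl rfl)), fun k hk =>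
      (hV k).2 (mem_closedBall_of_mem_separators hr.le (hA i hi) (hA j hj) hk)⟩)
    (fun i _ j _ hδd hdK => ?_)
    (fun i _ j _ hKd => h.one_sub_pow_card_separators_le hl hlr (by exact_mod_cast hK) hKr hKd.le)
  have hg : 1 ≤ dist (y j) (y i) / (10 * l / r) := (one_le_div hδ).2 hδd.le
  have hgδ := div_mul_cancel₀ (dist (y j) (y i)) hδ.ne'
  refine (h.one_sub_pow_card_separators_le hl hlr hg (hgδ.trans_le (hdK.trans hKr))
    hgδ.le).trans (Real.exp_le_exp.2 ?_)
  nlinarith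

theorem IsTypical.hasSensors {n : ℕ} {x : Fin n → ℝ × ℝ} {c : SupTorus √(n : ℝ)}
    (h : IsTypical r l K m c (toSupTorus n ∘ x)) (hl : 0 < l) (hlr : 100 * l ≤ r)
    (hrl : r ^ 2 ≤ l ^ 3) (hK : 0 < K) (hKr : K * (10 * l / r) ≤ r)
    (hfar : 4 * 10 ^ 20 * r ^ 4 ≤ Real.exp (5000 * K * (l ^ 3 / r ^ 2))) :
    HasSensors r (2 * 10 ^ 14 * l ^ 2 + 6 * m + 1) x c := by
  have hr : 0 < r := by linarith
  set A := hits (Metric.closedBall c (5 * 10 ^ 4 * r - r)) (toSupTorus n ∘ x)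
  set V := hits (Metric.closedBall c (5 * 10 ^ 4 * r)) (toSupTorus n ∘ x)
  have hAV : A ⊆ V := fun i hi =>
    mem_hits.2 (Metric.closedBall_subset_closedBall (by linarith) (mem_hits.1 hi))
  have hVcard : (V.card : ℝ) ≤ 2 * (10 ^ 10 * r ^ 2) := h.card_lt.le
  obtain ⟨W, hWV, hcard, hW⟩ := h.exists_hittingSet (A := A) (V := V) hl hlr hrl hK hKr
    (fun _ => mem_hits.1) (fun _ => mem_hits)
  refine ⟨W, hWV, hcard.trans ?_, distinguishes_of_not_disjoint_separators hW⟩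
  have hbudget : 10 ^ 4 * l ^ 2 / r ^ 2 * V.card ≤ 2 * 10 ^ 14 * l ^ 2 :=
    calc _ ≤ 10 ^ 4 * l ^ 2 / r ^ 2 * (2 * (10 ^ 10 * r ^ 2)) := by gcongr
      _ = 2 * 10 ^ 14 * l ^ 2 := by field_simp
  have hmissed : (A.card : ℝ) ^ 2 * Real.exp (-(5000 * K * (l ^ 3 / r ^ 2))) ≤ 1 := by
    rw [Real.exp_neg, ← div_eq_mul_inv, div_le_one (Real.exp_pos _)]
    calc (A.card : ℝ) ^ 2 ≤ (2 * (10 ^ 10 * r ^ 2)) ^ 2 := by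
          gcongr
          exact (Nat.cast_le.2 (Finset.card_le_card hAV)).trans hVcard
      _ = 4 * 10 ^ 20 * r ^ 4 := by ring
      _ ≤ _ := hfar
  linarith

end SparseSensors

section Scales

theorem sq_log_mul_le {r l : ℝ} (hr : 1 ≤ r) (hl : 0 < l) (hrl : r ^ 2 ≤ l ^ 3) :
    (r ^ 2 * Real.log r / (300 * l ^ 3)) ^ 2 * l ≤ r / 2500 := by
  obtain ⟨t, ht1, rfl⟩ : ∃ t : ℝ, 1 ≤ t ∧ t ^ 6 = r :=
    ⟨r ^ (1 / 6 : ℝ), Real.one_le_rpow hr (by norm_num), by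
      rw [← Real.rpow_natCast, ← Real.rpow_mul (by linarith)]
      norm_num⟩
  have htl : t ^ 4 ≤ l :=
    le_of_pow_le_pow_left₀ three_ne_zero hl.le (by linarith [hrl])
  have hlog0 : 0 ≤ Real.log (t ^ 6) := Real.log_nonneg hr
  have hlog : Real.log (t ^ 6) ≤ 6 * t := by
    rw [Real.log_pow]
    push_cast
    linarith [Real.log_le_sub_one_of_pos (by linarith : 0 < t)]
  calc ((t ^ 6) ^ 2 * Real.log (t ^ 6) / (300 * l ^ 3)) ^ 2 * l
      ≤ ((t ^ 6) ^ 2 * (6 * t) / (300 * l ^ 3)) ^ 2 * l := by gcongr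
    _ = t ^ 6 / 2500 * ((t ^ 4) ^ 5 / l ^ 5) := by field_simp; ring
    _ ≤ t ^ 6 / 2500 * 1 := by
        gcongr
        exact div_le_one_of_le₀ (by gcongr) (by positivity)
    _ = t ^ 6 / 2500 := mul_one _

theorem exists_numScales {r l : ℝ} (hl : 10 ≤ l) (hlr : 100 * l ≤ r) (hrl : r ^ 2 ≤ l ^ 3) :
    ∃ K : ℕ, 0 < K ∧ 20 * K ^ 2 * l ≤ r ∧
      4 * 10 ^ 20 * r ^ 4 ≤ Real.exp (5000 * K * (l ^ 3 / r ^ 2)) := by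
  have hr : 1000 ≤ r := by linarith
  have hlog : 0 < Real.log r := Real.log_pos (by linarith)
  set q := r ^ 2 * Real.log r / (300 * l ^ 3) with hq
  have hq0 : 0 < q := by positivity
  have hqK : q ≤ ⌈q⌉₊ := Nat.le_ceil q
  refine ⟨⌈q⌉₊, Nat.ceil_pos.2 hq0, ?_, ?_⟩
  · have hceil : (⌈q⌉₊ : ℝ) ≤ q + 1 := (Nat.ceil_lt_add_one hq0.le).le
    have hql : q ^ 2 * l ≤ r / 2500 := sq_log_mul_le (by linarith) (by linarith) hrl
    calc 20 * (⌈q⌉₊ : ℝ) ^ 2 * l ≤ 20 * (q + 1) ^ 2 * l := by gcongr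
      _ ≤ 20 * (2 * q ^ 2 + 2) * l := by
          gcongr
          nlinarith [sq_nonneg (q - 1)]
      _ = 40 * (q ^ 2 * l) + 40 * l := by ring
      _ ≤ r := by linarith
  · have hexponent : 16 * Real.log r ≤ 5000 * ⌈q⌉₊ * (l ^ 3 / r ^ 2) := by
      calc 16 * Real.log r ≤ 5000 / 300 * Real.log r := by gcongr; norm_num
        _ = 5000 * q * (l ^ 3 / r ^ 2) := by rw [hq]; field_simp
        _ ≤ _ := by gcongr
    calc 4 * 10 ^ 20 * r ^ 4 ≤ 1000 ^ 12 * r ^ 4 := by gcongr; norm_num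
      _ ≤ r ^ 12 * r ^ 4 := by gcongr
      _ = Real.exp (16 * Real.log r) := by
          rw [← pow_add, ← Real.rpow_natCast, Real.rpow_def_of_pos (by linarith)]
          norm_num [mul_comm]
      _ ≤ _ := Real.exp_le_exp.2 hexponent

end Scales

section Probability

variable {n : ℕ} {r l w : ℝ}

theorem hasSensors_of_hitCount_le {x : Fin n → ℝ × ℝ} {c : SupTorus √(n : ℝ)} (hr : 0 ≤ r)
    (h : (hitCount (Metric.closedBall c (5 * 10 ^ 4 * r)) (toSupTorus n ∘ x) : ℝ) ≤ w) :
    HasSensors r w x c :=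
  ⟨_, subset_rfl, h, distinguishes_of_not_disjoint_separators fun i hi _ _ _ =>
    Finset.not_disjoint_iff.2 ⟨i, mem_separators.2 (.inl rfl), mem_hits.2
      (Metric.closedBall_subset_closedBall (by linarith) (mem_hits.1 hi))⟩⟩

theorem exp_neg_natCast_mul_le {a : ℝ} (ha : 0 < a) (hal : Real.log a ≤ l) (k : ℕ) :
    Real.exp (-(k * l)) ≤ 1 / a ^ k := by
  rw [Real.exp_neg, Real.exp_nat_mul, one_div]
  gcongr
  exact (Real.log_le_iff_le_exp ha).1 hal

variable [Fact (0 < √(n : ℝ))]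

theorem one_sub_le_pointsLaw_localizable_mul_sq (hn : 0 < n) (hr : 1 ≤ r)
    (hlog : Real.log n ≤ r ^ 2) :
    1 - ENNReal.ofReal (2 / n) ≤ pointsLaw n (localizable n r (2 * 10 ^ 10 * r ^ 2)) := by
  have hn0 : (0 : ℝ) < n := by exact_mod_cast hn
  refine le_trans ?_ (one_sub_le_pointsLaw_localizable hr
    (fun c => measureReal_crowded_le c (zero_le_one.trans hr))
    (fun x c hx => hasSensors_of_hitCount_le (zero_le_one.trans hr)
      ((not_le.1 hx).le.trans_eq (mul_assoc _ _ _).symm)))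
  gcongr
  calc (n : ℝ) ^ 2 * Real.exp (-(10 ^ 10 * r ^ 2 / 4))
      ≤ (n : ℝ) ^ 2 * Real.exp (-((3 : ℕ) * r ^ 2)) := by
        gcongr
        push_cast
        linarith [sq_nonneg r]
    _ ≤ (n : ℝ) ^ 2 * (1 / n ^ 3) := by
        gcongr
        exact exp_neg_natCast_mul_le hn0 hlog 3
    _ = 1 / (n : ℝ) := by field_simp
    _ ≤ 2 / (n : ℝ) := by gcongr; norm_num

theorem one_sub_le_pointsLaw_localizable_of_sq_le_cube (hn : 12 ≤ n) (hrn : r ≤ √(n : ℝ) / 4)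
    (hl : 10 ≤ l) (hlog : Real.log n ≤ l) (hlr : 100 * l ≤ r) (hrl : r ^ 2 ≤ l ^ 3) :
    1 - ENNReal.ofReal (2 / n) ≤ pointsLaw n (localizable n r (10 ^ 15 * l ^ 2)) := by
  have hn0 : (12 : ℝ) ≤ n := by exact_mod_cast hn
  have hr : 0 < r := by linarith
  obtain ⟨K, hK0, hK, hfar⟩ := exists_numScales hl hlr hrl
  have hKr : (K : ℝ) ≤ r := by
    have hK1 : (1 : ℝ) ≤ K := by exact_mod_cast hK0
    nlinarith
  have hKlr : K * (10 * l / r) ≤ r :=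
    (mul_le_of_le_one_right K.cast_nonneg ((div_le_one hr).2 (by linarith))).trans hKr
  have hm : (⌈24 * 10 ^ 12 * l ^ 2⌉₊ : ℝ) ≤ 24 * 10 ^ 12 * l ^ 2 + 1 :=
    (Nat.ceil_lt_add_one (by positivity)).le
  refine le_trans ?_ ((one_sub_le_pointsLaw_localizable (by linarith)
    (measureReal_not_isTypical_le hn hl (by linarith) hrn hK (Nat.le_ceil _))
    (fun x c hx => (not_not.1 hx).hasSensors (by linarith) hlr hrl hK0 hKlr hfar)).trans
    (measure_mono (localizable_mono (by nlinarith))))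
  gcongr
  have hexp : Real.exp (-(5 * l)) ≤ 1 / (n : ℝ) ^ 5 := by
    exact_mod_cast exp_neg_natCast_mul_le (by linarith) hlog 5
  have hKn : (K : ℝ) + 2 ≤ n ^ 2 := by
    nlinarith [Real.sq_sqrt (n.cast_nonneg : (0 : ℝ) ≤ n), Real.sqrt_nonneg (n : ℝ)]
  calc (n : ℝ) ^ 2 * ((K + 2 + n ^ 2) * Real.exp (-(5 * l)))
      ≤ n ^ 2 * ((n ^ 2 + n ^ 2) * (1 / n ^ 5)) := by gcongr
    _ = 2 / (n : ℝ) := by field_simp; norm_num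

theorem one_sub_le_pointsLaw_localizable_rpow (hn : 12 ≤ n) (hr : 1 ≤ r)
    (hrn : r ≤ √(n : ℝ) / 4) (hlog : Real.log n ^ (3 / 2 : ℝ) ≤ r) :
    1 - ENNReal.ofReal (2 / n) ≤ pointsLaw n (localizable n r (10 ^ 15 * r ^ (4 / 3 : ℝ))) := by
  obtain ⟨l, hl1, hl2, hl3, hlogl⟩ : ∃ l : ℝ, 1 ≤ l ∧ l ^ 2 = r ^ (4 / 3 : ℝ) ∧ l ^ 3 = r ^ 2 ∧
      Real.log n ≤ l := by
    refine ⟨r ^ (2 / 3 : ℝ), Real.one_le_rpow hr (by norm_num), ?_, ?_, ?_⟩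
    · rw [← Real.rpow_mul_natCast (by linarith)]
      norm_num
    · rw [← Real.rpow_mul_natCast (by linarith)]
      norm_num
    · calc Real.log n = (Real.log n ^ (3 / 2 : ℝ)) ^ (2 / 3 : ℝ) := by
            rw [← Real.rpow_mul (Real.log_natCast_nonneg n)]
            norm_num
        _ ≤ r ^ (2 / 3 : ℝ) := by gcongr
  rw [← hl2]
  rcases le_total l (10 ^ 4) with hl | hl
  · have hbudget : 2 * 10 ^ 10 * r ^ 2 ≤ 10 ^ 15 * l ^ 2 := by
      rw [← hl3]
      nlinarith
    exact (one_sub_le_pointsLaw_localizable_mul_sq (by omega) hr (hlogl.trans (by nlinarith))).trans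
      (measure_mono (localizable_mono hbudget))
  · refine one_sub_le_pointsLaw_localizable_of_sq_le_cube hn hrn (by linarith) hlogl
      (le_of_sq_le_sq ?_ (by linarith)) hl3.ge
    nlinarith

theorem one_sub_le_pointsLaw_localizable_sensorBound (hn : 12 ≤ n) (hr : 1 ≤ r)
    (hlog : Real.log n ≤ r ^ 2) (hrn : r ≤ √(n : ℝ) / 4) :
    1 - ENNReal.ofReal (2 / n) ≤ pointsLaw n (localizable n r (sensorBound n r)) := by
  unfold sensorBound
  split_ifs with hlarge hmedium
  · exact one_sub_le_pointsLaw_localizable_rpow hn hr hrn hlarge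
  · have hlog0 : 0 < Real.log n := Real.log_pos (by exact_mod_cast (by omega : 1 < n))
    have hcube : r ^ 2 ≤ Real.log n ^ 3 := by
      calc r ^ 2 ≤ (Real.log n ^ (3 / 2 : ℝ)) ^ 2 := by gcongr; exact (not_le.1 hlarge).le
        _ = Real.log n ^ 3 := by
          rw [← Real.rpow_mul_natCast hlog0.le]
          norm_num
    have hten : 10 ≤ Real.log n := by
      by_contra! hlt
      nlinarith [pow_pos hlog0 2]
    refine (one_sub_le_pointsLaw_localizable_of_sq_le_cube hn hrn hten le_rfl hmedium hcube).trans
      (measure_mono (localizable_mono ?_))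
    linarith [sq_nonneg (Real.log n)]
  · exact one_sub_le_pointsLaw_localizable_mul_sq (by omega) hr hlog

end Probability

end LocalizationRGG

theorem mainTheorem3_general {n : ℕ} {r : ℝ} (hr : √(Real.log n) ≤ r) (hrn : r < √(n : ℝ) / 4) :
    1 - ENNReal.ofReal (2 / n) ≤ LocalizationRGG.pointsLaw n
      {x | ∀ S ∈ LocalizationRGG.squareFamily n r,
        ∃ W : Finset (Fin n),
          (W : Set (Fin n)) ⊆ LocalizationRGG.verticesIn x S ∧
          (W.card : ℝ) ≤ LocalizationRGG.sensorBound n r ∧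
          LocalizationRGG.Distinguishes (LocalizationRGG.torusGraph r x) W
            (LocalizationRGG.verticesIn x (S.internal r))} := by
  have hsqrt : 0 < √(n : ℝ) := by linarith [Real.sqrt_nonneg (Real.log n)]
  have hn : (0 : ℝ) < n := Real.sqrt_pos.1 hsqrt
  rcases le_or_gt n 2 with hsmall | hlarge
  · have htwo : 1 ≤ 2 / (n : ℝ) := (one_le_div hn).2 (by exact_mod_cast hsmall)
    rw [tsub_eq_zero_of_le (ENNReal.one_le_ofReal.2 htwo)]
    exact zero_le
  · have hthree : (3 : ℝ) ≤ n := by exact_mod_cast hlarge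
    have hlog : 1 ≤ Real.log n :=
      (Real.le_log_iff_exp_le hn).2 (Real.exp_one_lt_three.le.trans hthree)
    have hr1 : 1 ≤ r := (Real.one_le_sqrt.2 hlog).trans hr
    have hsixteen : (4 : ℝ) ^ 2 ≤ n := (Real.le_sqrt' four_pos).1 (by linarith)
    have hn12 : 12 ≤ n := by
      norm_num at hsixteen
      omega
    have := Fact.mk hsqrt
    exact LocalizationRGG.one_sub_le_pointsLaw_localizable_sensorBound hn12 hr1
      ((Real.sqrt_le_left (by linarith)).1 hr) hrn.le

theorem mainTheorem3 (r : ℕ → ℝ)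
    (hr : ∀ᶠ n : ℕ in atTop, 70 * √(Real.log n) ≤ r n ∧ r n < √(n : ℝ) / 4) :
    Tendsto
      (fun n : ℕ => LocalizationRGG.pointsLaw n
        {x | ∀ S ∈ LocalizationRGG.squareFamily n (r n),
          ∃ W : Finset (Fin n),
            (W : Set (Fin n)) ⊆ LocalizationRGG.verticesIn x S ∧
            (W.card : ℝ) ≤ LocalizationRGG.sensorBound n (r n) ∧
            LocalizationRGG.Distinguishes (LocalizationRGG.torusGraph (r n) x) W
              (LocalizationRGG.verticesIn x (S.internal (r n)))})
      atTop (𝓝 1) := by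
  have hlim : Tendsto (fun n : ℕ => 1 - ENNReal.ofReal (2 / (n : ℝ))) atTop (𝓝 1) := by
    simpa using ENNReal.Tendsto.sub (tendsto_const_nhds (x := (1 : ENNReal)))
      (ENNReal.tendsto_ofReal (tendsto_const_div_atTop_nhds_zero_nat (2 : ℝ)))
      (.inl ENNReal.one_ne_top)
  refine tendsto_of_tendsto_of_tendsto_of_le_of_le' hlim tendsto_const_nhds ?_ ?_
  · filter_upwards [hr] with n ⟨hlog, hrn⟩
    exact mainTheorem3_general (by linarith [Real.sqrt_nonneg (Real.log n)]) hrn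
  · filter_upwards [eventually_gt_atTop 0] with n hn
    have : Fact (0 < √(n : ℝ)) := ⟨Real.sqrt_pos.2 (by exact_mod_cast hn)⟩
    exact prob_le_one
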